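/- Let $P$ be a poset, $R$ a commutative ring with unit, $\bar p,\bar q\colon P\to\mathbb Z\cup\{\pm\infty\}$ two perversities (maps vanishing on the maximal elements of $P$) and $n,m$ two integers. Let $\mathrm{Sset}_P$ be the category of presheaves of sets on the category of simplices of the nerve $N(P)$. A simplex $\sigma=\Delta[q_0]*\dots*\Delta[q_\ell]$ of $N(P)$, where the vertices of $\Delta[q_i]$ are sent to $s_i$ and $s_0\prec\dots\prec s_\ell$, is regular if $s_\ell$ is maximal in $P$. For $\sigma$ regular, let $\widetilde N^*(\sigma)=N^*(c\Delta[q_0])\otimes\dots\otimes N^*(c\Delta[q_{\ell-1}])\otimes N^*(\Delta[q_\ell])$, where $N^*$ denotes the normalized simplicial cochains with coefficients in $R$ and $c$ the cone; for $\sigma$ not regular, let $\widetilde N^*(\sigma)=0$. A basis cochain $\mathbf 1_{F_0'}\otimes\dots\otimes\mathbf 1_{F_\ell'}$ has perverse degree $\dim(F_{i+1}'\times\dots\times F_\ell')$ along $s_i$ if $F_i'$ does not contain the apex of $c\Delta[q_i]$ (this condition being void for $i=\ell$), and perverse degree $-\infty$ along every other element of $P$; the perverse degree of a cochain is the maximum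 over the basis cochains with a nonzero coefficient. Let $\widetilde N^*_{\bar p}(\sigma)$ be the complex of the cochains $\omega$ such that $\omega$ and $\delta\omega$ have perverse degree at most $\bar p(s)$ along every $s\in P$. For $L\in\mathrm{Sset}_P$, let $\widetilde N^k_{\bar p}(L)=\mathrm{Hom}_{\mathrm{Sset}_P}(L,\widetilde N^k_{\bar p}(\bullet))$, and let $\mathscr H^*_{\bar p}(L;R)$ be the cohomology of the complex $\widetilde N^*_{\bar p}(L)$. Let $K(R,n,P,\bar p)\in\mathrm{Sset}_P$ be the presheaf sending $\sigma$ to the set of $n$-cocycles of $\widetilde N^*_{\bar p}(\sigma)$; a morphism $f\colon L\to K(R,n,P,\bar p)$ is then an $n$-cocycle of $\widetilde N^*_{\bar p}(L)$, whose cohomology class is denoted $\langle f\rangle\in\mathscr H^n_{\bar p}(L;R)$. Denote by $[L,K]$ the set of connected components of the simplicial mapping space from $L$ to $K$, i.e. of morphisms $L\to K$ modulo the equivalence relation generated by homotopies $L\otimes\Delta[1]\to K$. Let $\mathrm{Nat}_R(\mathscr H^n_{\bar p},\mathscr H^m_{\bar q})$ be the set of natural transformations, between functors from $\mathrm{Sset}_P^{\mathrm{op}}$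 to sets (not necessarily additive), from $\mathscr H^n_{\bar p}(-;R)$ to $\mathscr H^m_{\bar q}(-;R)$; it is an $R$-module for the pointwise operations. Then there are a bijection and an isomorphism of $R$-modules $$[K(R,n,P,\bar p),K(R,m,P,\bar q)]\;\xrightarrow{\ \Phi\ }\;\mathrm{Nat}_R(\mathscr H^n_{\bar p},\mathscr H^m_{\bar q})\;\xrightarrow{\ e\ }\;\mathscr H^m_{\bar q}(K(R,n,P,\bar p);R)$$ such that $\Phi[f]$ sends $\langle g\rangle$ to $\langle f\circ g\rangle$ for every $L\in\mathrm{Sset}_P$ and every morphism $g\colon L\to K(R,n,P,\bar p)$, such that $e(\theta)=\theta(\langle\mathrm{id}\rangle)$ is the value of $\theta$ on the fundamental class of $K(R,n,P,\bar p)$, and such that $e(\Phi[f])=\langle f\rangle$. -/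

import Mathlib

open CategoryTheory Opposite

universe u

/-! ## Simplicial sets over a poset -/

/-- A simplex of the nerve of the poset `P`: an order preserving map `[dim] → P`, that is, a simplex
`s₀ ≼ s₁ ≼ ⋯ ≼ s_dim`, or, equivalently, a simplicial map `Δ[dim] → N(P)`. These are the objects
of the category of simplices `Δ[P]` of the nerve of `P`. -/
structure NerveSimplex (P : Type u) [PartialOrder P] where
  /-- The dimension of the simplex. -/
  dim : ℕ
  /-- The sequence of vertices of the simplex. -/
  vertex : Fin (dim + 1) →o P

namespace NerveSimplex

variable {P : Type u} [PartialOrder P]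

/-- A morphism of `Δ[P]`: an order preserving map `[k] → [l]` (that is, a simplicial map
`Δ[k] → Δ[l]`) over the nerve of `P`. -/
@[ext]
structure Hom (τ σ : NerveSimplex P) where
  /-- The underlying order preserving map. -/
  toOrderHom : Fin (τ.dim + 1) →o Fin (σ.dim + 1)
  /-- The triangle over the nerve of `P` commutes. -/
  comm : ∀ i, σ.vertex (toOrderHom i) = τ.vertex i

instance : Category (NerveSimplex P) where
  Hom := Hom
  id σ := ⟨OrderHom.id, fun _ => rfl⟩
  comp f g := ⟨g.toOrderHom.comp f.toOrderHom, fun i => (g.comm _).trans (f.comm i)⟩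

theorem id_apply (σ : NerveSimplex P) (i : Fin (σ.dim + 1)) :
    Hom.toOrderHom (𝟙 σ) i = i := rfl

theorem comp_apply {ρ τ σ : NerveSimplex P} (f : ρ ⟶ τ) (g : τ ⟶ σ) (i : Fin (ρ.dim + 1)) :
    Hom.toOrderHom (f ≫ g) i = Hom.toOrderHom g (Hom.toOrderHom f i) := rfl

/-- A simplex of the nerve is regular if its last vertex is a maximal element of the poset. -/
def Regular (σ : NerveSimplex P) : Prop := IsMax (σ.vertex (Fin.last σ.dim))

end NerveSimplex

/-- Simplicial sets over the poset `P`: presheaves on the category of simplices of the nerve of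
`P`. -/
abbrev SSetOver (P : Type u) [PartialOrder P] := (NerveSimplex P)ᵒᵖ ⥤ Type u

namespace SSetOver

variable {P : Type u} [PartialOrder P]

/-- The simplicial set `L ⊗ Δ[1]` over `P`: a simplex over `σ : Δ[k] → N(P)` is a pair of a simplex
of `L` over `σ` and a `k`-simplex of `Δ[1]`, i.e. an order preserving map `[k] → [1]`. -/
def cylinder (L : SSetOver P) : SSetOver P where
  obj σ := L.obj σ × (Fin (σ.unop.dim + 1) →o Fin 2)
  map f := ↾(fun x => (L.map f x.1, x.2.comp f.unop.toOrderHom))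
  map_id σ := by
    ext x
    · simp
    · rfl
  map_comp f g := by
    ext x
    · simp
    · rfl

/-- The inclusion `L ≅ L ⊗ {j} → L ⊗ Δ[1]` of an end of the cylinder, for `j = 0, 1`. -/
def endInclusion (L : SSetOver P) (j : Fin 2) : L ⟶ cylinder L where
  app _ := ↾(fun x => (x, OrderHom.const _ j))
  naturality _ _ _ := rfl

/-- The morphisms `f` and `g` are strictly homotopic: they are the two ends of a morphism
`L ⊗ Δ[1] → K`, i.e. of a `1`-simplex of the simplicial mapping space from `L` to `K`. -/
def StrictlyHomotopic {L K : SSetOver P} (f g : L ⟶ K) : Prop :=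
  ∃ H : cylinder L ⟶ K, endInclusion L 0 ≫ H = f ∧ endInclusion L 1 ≫ H = g

/-- The set `[L, K]` of homotopy classes, i.e. of connected components of the simplicial mapping
space from `L` to `K`: the quotient of the set of morphisms by the equivalence relation
generated by strict homotopies. -/
def HomotopyClasses (L K : SSetOver P) : Type u :=
  Quot (StrictlyHomotopic (L := L) (K := K))

/-- The homotopy class of a morphism. -/
def homotopyClass {L K : SSetOver P} (f : L ⟶ K) : HomotopyClasses L K := Quot.mk _ f

end SSetOver

/-! ## Perversities and blown up cochains -/

/-- A perversity on a poset: a map to `ℤ ∪ {-∞, ∞}` with value `0` on the maximal elements. -/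
structure Perversity (P : Type u) [PartialOrder P] where
  /-- The values of the perversity. -/
  toFun : P → WithBot (WithTop ℤ)
  /-- A perversity vanishes on the maximal elements. -/
  eq_zero_of_isMax : ∀ s, IsMax s → toFun s = 0

namespace BlowUp

variable {P : Type u} [PartialOrder P] (R : Type u) [CommRing R]

/-! Let `σ = Δ[q₀] ∗ ⋯ ∗ Δ[q_ℓ]` be a regular simplex of the nerve of `P`, where `Δ[q_i]` is spanned
by the vertices sent to `s_i` and `s₀ ≺ ⋯ ≺ s_ℓ`. A face
`(F, ε) = (F₀, ε₀) × ⋯ × (F_{ℓ-1}, ε_{ℓ-1}) × F_ℓ` of its blow up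
`cΔ[q₀] × ⋯ × cΔ[q_{ℓ-1}] × Δ[q_ℓ]` is encoded by a pair `(F, G)`, where `F` is the set of all the
vertices of the `F_i`, and `G` is the set of those `s_i` with `ε_i = 0`, i.e. such that the
`i`-th factor of the face does not contain the apex of the cone `cΔ[q_i]`; by convention
`ε_ℓ = 0`, so that `s_ℓ ∈ G`. As `ε_i = 1` if `F_i = ∅`, every element of `G` is the image of an
element of `F`. -/

open scoped Classical in
/-- The pair `(F, G)` encodes a face of the blow up of the simplex `σ`, which has to be regular
(the blow up of a simplex which is not regular has no face). -/
def IsFace (σ : NerveSimplex P) (F : Finset (Fin (σ.dim + 1))) (G : Finset P) : Prop :=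
  σ.Regular ∧ σ.vertex (Fin.last σ.dim) ∈ G ∧ G ⊆ F.image σ.vertex

/-- The dimension of the face `(F, G)`. The `i`-th factor has dimension `#F_i - 1 + ε_i`, and the
sum over `i` is `#F - #G`. -/
def faceDim {σ : NerveSimplex P} (F : Finset (Fin (σ.dim + 1))) (G : Finset P) : ℤ :=
  (F.card : ℤ) - (G.card : ℤ)

open scoped Classical in
/-- The perverse degree of the face `(F, G)` along `s`: it is `-∞` unless `s = s_i` with `ε_i = 0`,
and in this case it is the dimension of the product of the factors with index `> i`. -/
noncomputable def perverseDegree {σ : NerveSimplex P} (F : Finset (Fin (σ.dim + 1)))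
    (G : Finset P) (s : P) : WithBot (WithTop ℤ) :=
  if s ∈ G then
    (((faceDim (F.filter fun v => s < σ.vertex v) (G.filter fun t => s < t) : ℤ) :
      WithTop ℤ) : WithBot (WithTop ℤ))
  else ⊥

/-- Families of coefficients indexed by all pairs `(F, G)`. A blown up cochain on `σ` is the family
of its coefficients in the basis `1_{(F, ε)}`, extended by zero to the pairs `(F, G)` which
are not a face. -/
abbrev Coeffs (σ : NerveSimplex P) : Type u := Finset (Fin (σ.dim + 1)) → Finset P → R

variable {R}

open scoped Classical in
/-- The exponent of the sign with which the removal of the vertex `v` from the face `(F, G)`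
contributes to the boundary: the sum of the dimensions of the factors before that of `v`, plus
the position of `v` in its factor (modulo `2`). -/
noncomputable def vertexSign (σ : NerveSimplex P) (F : Finset (Fin (σ.dim + 1))) (G : Finset P)
    (v : Fin (σ.dim + 1)) : ℕ :=
  (F.filter fun w => w < v).card + (G.filter fun t => t < σ.vertex v).card

open scoped Classical in
/-- The exponent of the sign with which the removal of the apex of the cone over the `s`-factor
contributes to the boundary, the apex being the last vertex of the cone. -/
noncomputable def apexSign (σ : NerveSimplex P) (F : Finset (Fin (σ.dim + 1))) (G : Finset P)
    (s : P) : ℕ :=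
  (F.filter fun w => σ.vertex w ≤ s).card + (G.filter fun t => t < s).card

open scoped Classical in
/-- The elements `s` of the poset such that the `s`-factor of the face `(F, G)` is the cone on a
nonempty simplex. -/
noncomputable def coned (σ : NerveSimplex P) (F : Finset (Fin (σ.dim + 1))) (G : Finset P) :
    Finset P :=
  (F.image σ.vertex \ G).filter fun s => ¬ IsMax s

open scoped Classical in
/-- The differential of the tensor product
`N^*(cΔ[q₀]) ⊗ ⋯ ⊗ N^*(cΔ[q_{ℓ-1}]) ⊗ N^*(Δ[q_ℓ])`. The value of `δ ω` on a face is the value of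
`ω` on the boundary of that face: the first sum is over the removal of a vertex of some `F_i`,
the second one over the removal of the apex of a cone. -/
noncomputable def coboundary (σ : NerveSimplex P) : Coeffs R σ →ₗ[R] Coeffs R σ where
  toFun ω F G :=
    (∑ v ∈ F, (-1) ^ vertexSign σ F G v * ω (F.erase v) G) +
      ∑ s ∈ coned σ F G, (-1) ^ apexSign σ F G s * ω F (insert s G)
  map_add' ω η := by
    funext F G
    simp only [Pi.add_apply, mul_add, Finset.sum_add_distrib]
    ring
  map_smul' a ω := by
    funext F G
    simp only [Pi.smul_apply, smul_eq_mul, RingHom.id_apply, mul_add, Finset.mul_sum]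
    congr 1 <;> exact Finset.sum_congr rfl fun _ _ => by ring

variable (R)

/-- The module of blown up cochains of degree `n` on the simplex `σ`; it is zero if `σ` is not
regular. -/
def cochains (n : ℤ) (σ : NerveSimplex P) : Submodule R (Coeffs R σ) where
  carrier := {ω | ∀ F G, ω F G ≠ 0 → IsFace σ F G ∧ faceDim F G = n}
  zero_mem' F G h := absurd rfl h
  add_mem' {ω η} hω hη F G h := by
    by_cases h0 : ω F G = 0
    · refine hη F G fun h1 => h ?_
      simp [h0, h1]
    · exact hω F G h0
  smul_mem' a ω hω F G h := hω F G fun h0 => h (by simp [h0])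

/-- The module of the `p`-allowable families of coefficients: the perverse degree of each face
with a nonzero coefficient is at most `p`. -/
def allowable (p : Perversity P) (σ : NerveSimplex P) : Submodule R (Coeffs R σ) where
  carrier := {ω | ∀ F G, ω F G ≠ 0 → ∀ s, perverseDegree F G s ≤ p.toFun s}
  zero_mem' F G h := absurd rfl h
  add_mem' {ω η} hω hη F G h := by
    by_cases h0 : ω F G = 0
    · refine hη F G fun h1 => h ?_
      simp [h0, h1]
    · exact hω F G h0
  smul_mem' a ω hω F G h := hω F G fun h0 => h (by simp [h0])

/-- The module of cochains of `p`-intersection of degree `n` on the simplex `σ`: the blown up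
cochains `ω` such that `ω` and `δ ω` are `p`-allowable. -/
noncomputable def intersectionCochains (p : Perversity P) (n : ℤ) (σ : NerveSimplex P) :
    Submodule R (Coeffs R σ) :=
  cochains R n σ ⊓ allowable R p σ ⊓ (allowable R p σ).comap (coboundary σ)

/-- The module of cocycles of `p`-intersection of degree `n` on the simplex `σ`. -/
noncomputable def intersectionCocycles (p : Perversity P) (n : ℤ) (σ : NerveSimplex P) :
    Submodule R (Coeffs R σ) :=
  intersectionCochains R p n σ ⊓ LinearMap.ker (coboundary σ)

variable {R}

open scoped Classical in
/-- The map induced on blown up cochains by a morphism `θ : τ ⟶ σ` of simplices of the nerve. The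
blow up of `θ` is the product of the cones on the restrictions of `θ` (and of the inclusions of
the apex, for the factors of `σ` without counterpart in `τ`, whose `ε` is `1`); a face of the
blow up of `τ` is sent to the corresponding face of the blow up of `σ`, or to a degenerate
simplex if two vertices of the face have the same image. -/
noncomputable def pullback {τ σ : NerveSimplex P} (θ : τ ⟶ σ) : Coeffs R σ →ₗ[R] Coeffs R τ where
  toFun ω F G := if Set.InjOn θ.toOrderHom (F : Set (Fin (τ.dim + 1))) then
    ω (F.image θ.toOrderHom) G else 0
  map_add' ω η := by
    funext F G
    by_cases h : Set.InjOn θ.toOrderHom (F : Set (Fin (τ.dim + 1))) <;> simp [h]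
  map_smul' a ω := by
    funext F G
    by_cases h : Set.InjOn θ.toOrderHom (F : Set (Fin (τ.dim + 1))) <;> simp [h]

open scoped Classical in
theorem pullback_apply_of_injOn {τ σ : NerveSimplex P} (θ : τ ⟶ σ) (ω : Coeffs R σ)
    {F : Finset (Fin (τ.dim + 1))} (G : Finset P)
    (h : Set.InjOn θ.toOrderHom (F : Set (Fin (τ.dim + 1)))) :
    pullback θ ω F G = ω (F.image θ.toOrderHom) G := by
  simp only [pullback, LinearMap.coe_mk, AddHom.coe_mk]
  rw [if_pos h]

theorem pullback_apply_of_not_injOn {τ σ : NerveSimplex P} (θ : τ ⟶ σ) (ω : Coeffs R σ)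
    {F : Finset (Fin (τ.dim + 1))} (G : Finset P)
    (h : ¬ Set.InjOn θ.toOrderHom (F : Set (Fin (τ.dim + 1)))) :
    pullback θ ω F G = 0 := by
  simp only [pullback, LinearMap.coe_mk, AddHom.coe_mk]
  rw [if_neg h]

open scoped Classical in
theorem image_vertex {τ σ : NerveSimplex P} (θ : τ ⟶ σ) (F : Finset (Fin (τ.dim + 1))) :
    (F.image θ.toOrderHom).image σ.vertex = F.image τ.vertex := by
  rw [Finset.image_image]
  exact Finset.image_congr fun i _ => θ.comm i

theorem pullback_id (σ : NerveSimplex P) (ω : Coeffs R σ) : pullback (𝟙 σ) ω = ω := by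
  classical
  funext F G
  have h : Set.InjOn (NerveSimplex.Hom.toOrderHom (𝟙 σ)) (F : Set (Fin (σ.dim + 1))) :=
    fun a _ b _ hab => hab
  rw [pullback_apply_of_injOn _ _ _ h]
  congr 1
  ext i
  simp [NerveSimplex.id_apply]

theorem pullback_comp {ρ τ σ : NerveSimplex P} (φ : ρ ⟶ τ) (θ : τ ⟶ σ) (ω : Coeffs R σ) :
    pullback (φ ≫ θ) ω = pullback φ (pullback θ ω) := by
  classical
  funext F G
  by_cases hφ : Set.InjOn φ.toOrderHom (F : Set (Fin (ρ.dim + 1)))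
  · rw [pullback_apply_of_injOn _ _ _ hφ]
    by_cases h : Set.InjOn (φ ≫ θ).toOrderHom (F : Set (Fin (ρ.dim + 1)))
    · have hθ : Set.InjOn θ.toOrderHom
          ((F.image φ.toOrderHom : Finset _) : Set (Fin (τ.dim + 1))) := by
        intro a ha b hb hab
        simp only [Finset.coe_image, Set.mem_image] at ha hb
        obtain ⟨x, hx, rfl⟩ := ha
        obtain ⟨y, hy, rfl⟩ := hb
        rw [h hx hy hab]
      rw [pullback_apply_of_injOn _ _ _ h, pullback_apply_of_injOn _ _ _ hθ, Finset.image_image]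
      rfl
    · have hθ : ¬ Set.InjOn θ.toOrderHom
          ((F.image φ.toOrderHom : Finset _) : Set (Fin (τ.dim + 1))) := by
        intro hθ
        refine h fun a ha b hb hab => hφ ha hb (hθ ?_ ?_ hab)
        · simpa using ⟨a, ha, rfl⟩
        · simpa using ⟨b, hb, rfl⟩
      rw [pullback_apply_of_not_injOn _ _ _ h, pullback_apply_of_not_injOn _ _ _ hθ]
  · have h : ¬ Set.InjOn (φ ≫ θ).toOrderHom (F : Set (Fin (ρ.dim + 1))) := by
      intro h
      refine hφ fun a ha b hb hab => h ha hb ?_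
      rw [NerveSimplex.comp_apply, NerveSimplex.comp_apply, hab]
    rw [pullback_apply_of_not_injOn _ _ _ h, pullback_apply_of_not_injOn _ _ _ hφ]

theorem isFace_of_isFace_image {τ σ : NerveSimplex P} (θ : τ ⟶ σ)
    {F : Finset (Fin (τ.dim + 1))} {G : Finset P} [DecidableEq (Fin (σ.dim + 1))]
    (h : IsFace σ (F.image θ.toOrderHom) G) : IsFace τ F G := by
  classical
  obtain ⟨hr, hl, hs⟩ := h
  have hs' : G ⊆ F.image τ.vertex := by
    rw [← image_vertex θ]
    convert hs
  obtain ⟨i, _, hi⟩ := Finset.mem_image.1 (hs' hl)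
  have hle : σ.vertex (Fin.last σ.dim) ≤ τ.vertex (Fin.last τ.dim) := by
    rw [← hi]
    exact τ.vertex.monotone (Fin.le_last i)
  have heq : τ.vertex (Fin.last τ.dim) = σ.vertex (Fin.last σ.dim) :=
    le_antisymm (hr hle) hle
  refine ⟨?_, ?_, ?_⟩
  · unfold NerveSimplex.Regular
    rw [heq]
    exact hr
  · rwa [heq]
  · convert hs'

theorem pullback_mem_cochains {τ σ : NerveSimplex P} (θ : τ ⟶ σ) {n : ℤ} {ω : Coeffs R σ}
    (hω : ω ∈ cochains R n σ) : pullback θ ω ∈ cochains R n τ := by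
  classical
  intro F G h
  by_cases hθ : Set.InjOn θ.toOrderHom (F : Set (Fin (τ.dim + 1)))
  · rw [pullback_apply_of_injOn _ _ _ hθ] at h
    obtain ⟨h1, h2⟩ := hω _ _ h
    refine ⟨isFace_of_isFace_image θ h1, ?_⟩
    rw [← h2, faceDim, faceDim, Finset.card_image_of_injOn hθ]
  · exact absurd (pullback_apply_of_not_injOn _ _ _ hθ) h

theorem perverseDegree_image {τ σ : NerveSimplex P} (θ : τ ⟶ σ)
    {F : Finset (Fin (τ.dim + 1))} (G : Finset P) (s : P) [DecidableEq (Fin (σ.dim + 1))]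
    (hθ : Set.InjOn θ.toOrderHom (F : Set (Fin (τ.dim + 1)))) :
    perverseDegree (σ := σ) (F.image θ.toOrderHom) G s = perverseDegree (σ := τ) F G s := by
  classical
  have key : ((F.image θ.toOrderHom).filter fun v => s < σ.vertex v).card =
      (F.filter fun v => s < τ.vertex v).card := by
    rw [Finset.filter_image, Finset.card_image_of_injOn]
    · simp only [θ.comm]
    · exact hθ.mono fun x hx => (Finset.mem_filter.1 hx).1
  unfold perverseDegree faceDim
  rw [key]

theorem pullback_mem_allowable {τ σ : NerveSimplex P} (θ : τ ⟶ σ) {p : Perversity P}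
    {ω : Coeffs R σ} (hω : ω ∈ allowable R p σ) : pullback θ ω ∈ allowable R p τ := by
  classical
  intro F G h s
  by_cases hθ : Set.InjOn θ.toOrderHom (F : Set (Fin (τ.dim + 1)))
  · rw [pullback_apply_of_injOn _ _ _ hθ] at h
    rw [← perverseDegree_image θ G s hθ]
    exact hω _ _ h s
  · exact absurd (pullback_apply_of_not_injOn _ _ _ hθ) h

theorem vertexSign_image {τ σ : NerveSimplex P} (θ : τ ⟶ σ)
    {F : Finset (Fin (τ.dim + 1))} (G : Finset P) [DecidableEq (Fin (σ.dim + 1))]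
    (hθ : Set.InjOn θ.toOrderHom (F : Set (Fin (τ.dim + 1)))) {v : Fin (τ.dim + 1)}
    (hv : v ∈ F) :
    vertexSign σ (F.image θ.toOrderHom) G (θ.toOrderHom v) = vertexSign τ F G v := by
  classical
  have key : ((F.image θ.toOrderHom).filter fun w => w < θ.toOrderHom v).card =
      (F.filter fun w => w < v).card := by
    rw [Finset.filter_image, Finset.card_image_of_injOn
      (hθ.mono fun x hx => (Finset.mem_filter.1 hx).1)]
    congr 1
    refine Finset.filter_congr fun w hw => ⟨fun h => ?_, fun h => ?_⟩
    · exact lt_of_not_ge fun h' => absurd (θ.toOrderHom.monotone h') (not_le_of_gt h)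
    · exact lt_of_le_of_ne (θ.toOrderHom.monotone h.le) fun h' => h.ne (hθ hw hv h')
  unfold vertexSign
  rw [key, θ.comm]

theorem apexSign_image {τ σ : NerveSimplex P} (θ : τ ⟶ σ)
    {F : Finset (Fin (τ.dim + 1))} (G : Finset P) (s : P) [DecidableEq (Fin (σ.dim + 1))]
    (hθ : Set.InjOn θ.toOrderHom (F : Set (Fin (τ.dim + 1)))) :
    apexSign σ (F.image θ.toOrderHom) G s = apexSign τ F G s := by
  classical
  have key : ((F.image θ.toOrderHom).filter fun w => σ.vertex w ≤ s).card =
      (F.filter fun w => τ.vertex w ≤ s).card := by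
    rw [Finset.filter_image, Finset.card_image_of_injOn
      (hθ.mono fun x hx => (Finset.mem_filter.1 hx).1)]
    simp only [θ.comm]
  unfold apexSign
  rw [key]

theorem coboundary_apply (σ : NerveSimplex P) (ω : Coeffs R σ) (F : Finset (Fin (σ.dim + 1)))
    (G : Finset P) [DecidableEq P] :
    coboundary σ ω F G = (∑ v ∈ F, (-1) ^ vertexSign σ F G v * ω (F.erase v) G) +
      ∑ s ∈ coned σ F G, (-1) ^ apexSign σ F G s * ω F (insert s G) := by
  simp only [coboundary, LinearMap.coe_mk, AddHom.coe_mk]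
  congr!

/-- The maps induced by the morphisms of simplices are compatible with the differentials. -/
theorem pullback_coboundary {τ σ : NerveSimplex P} (θ : τ ⟶ σ) (ω : Coeffs R σ) :
    pullback θ (coboundary σ ω) = coboundary τ (pullback θ ω) := by
  classical
  funext F G
  by_cases hθ : Set.InjOn θ.toOrderHom (F : Set (Fin (τ.dim + 1)))
  · rw [pullback_apply_of_injOn _ _ _ hθ, coboundary_apply, coboundary_apply]
    congr 1
    · rw [Finset.sum_image hθ]
      refine Finset.sum_congr rfl fun v hv => ?_
      rw [vertexSign_image θ G hθ hv, pullback_apply_of_injOn]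
      · congr 2
        ext w
        simp only [Finset.mem_erase, Finset.mem_image]
        constructor
        · rintro ⟨hw, a, ha, rfl⟩
          exact ⟨a, ⟨fun h => hw (by rw [h]), ha⟩, rfl⟩
        · rintro ⟨a, ⟨hav, ha⟩, rfl⟩
          exact ⟨fun h => hav (hθ ha hv h), a, ha, rfl⟩
      · exact hθ.mono (by simp)
    · have hc : coned σ (F.image θ.toOrderHom) G = coned τ F G := by
        unfold coned
        rw [← image_vertex θ]
      rw [hc]
      refine Finset.sum_congr rfl fun s _ => ?_
      rw [apexSign_image θ G s hθ, pullback_apply_of_injOn _ _ _ hθ]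
  · rw [pullback_apply_of_not_injOn _ _ _ hθ, coboundary_apply]
    have h2 : ∑ s ∈ coned τ F G, (-1) ^ apexSign τ F G s * pullback θ ω F (insert s G) = 0 :=
      Finset.sum_eq_zero fun s _ => by
        rw [pullback_apply_of_not_injOn _ _ _ hθ, mul_zero]
    rw [h2, add_zero]
    have hex : ∃ a ∈ F, ∃ b ∈ F, a < b ∧ θ.toOrderHom a = θ.toOrderHom b := by
      unfold Set.InjOn at hθ
      push Not at hθ
      obtain ⟨a, ha, b, hb, hab, hne⟩ := hθ
      rcases lt_or_gt_of_ne hne with h | h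
      · exact ⟨a, ha, b, hb, h, hab⟩
      · exact ⟨b, hb, a, ha, h, hab.symm⟩
    obtain ⟨a, ha, b, hb, hlt, hab⟩ := hex
    symm
    rw [Finset.sum_eq_add_of_mem a b ha hb hlt.ne]
    · have hinj : ∀ x y, x ∈ F → y ∈ F → x ≠ y → θ.toOrderHom x = θ.toOrderHom y →
          Set.InjOn θ.toOrderHom ((F.erase x : Finset _) : Set (Fin (τ.dim + 1))) →
          Set.InjOn θ.toOrderHom ((F.erase y : Finset _) : Set (Fin (τ.dim + 1))) := by
        intro x y hx hy hxy he hi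
        have aux : ∀ c ∈ F, c ≠ y → θ.toOrderHom c = θ.toOrderHom x → c = x := by
          intro c hc hcy hcx
          by_contra hne
          exact hcy (hi (by simp [hne, hc]) (by simp [hxy.symm, hy]) (hcx.trans he))
        intro c hc d hd hcd
        simp only [Finset.coe_erase, Set.mem_sdiff, Finset.mem_coe, Set.mem_singleton_iff] at hc hd
        by_cases hcx : c = x
        · rw [hcx]
          exact (aux d hd.1 hd.2 (by rw [← hcd, hcx])).symm
        · by_cases hdx : d = x
          · rw [hdx]
            exact aux c hc.1 hc.2 (by rw [hcd, hdx])
          · exact hi (by simp [hcx, hc.1]) (by simp [hdx, hd.1]) hcd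
      by_cases hia : Set.InjOn θ.toOrderHom ((F.erase a : Finset _) : Set (Fin (τ.dim + 1)))
      · have hib := hinj a b ha hb hlt.ne hab hia
        rw [pullback_apply_of_injOn _ _ _ hia, pullback_apply_of_injOn _ _ _ hib]
        have him : (F.erase a).image θ.toOrderHom = (F.erase b).image θ.toOrderHom := by
          ext w
          simp only [Finset.mem_image, Finset.mem_erase]
          constructor
          · rintro ⟨c, ⟨hca, hc⟩, rfl⟩
            by_cases hcb : c = b
            · exact ⟨a, ⟨hlt.ne, ha⟩, by rw [hcb, hab]⟩
            · exact ⟨c, ⟨hcb, hc⟩, rfl⟩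
          · rintro ⟨c, ⟨hcb, hc⟩, rfl⟩
            by_cases hca : c = a
            · exact ⟨b, ⟨hlt.ne', hb⟩, by rw [hca, hab]⟩
            · exact ⟨c, ⟨hca, hc⟩, rfl⟩
        have hsign : vertexSign τ F G b = vertexSign τ F G a + 1 := by
          have hv : τ.vertex a = τ.vertex b := by rw [← θ.comm a, ← θ.comm b, hab]
          have hf : (F.filter fun w => w < b) = insert a (F.filter fun w => w < a) := by
            ext w
            simp only [Finset.mem_filter, Finset.mem_insert]
            constructor
            · rintro ⟨hw, hwb⟩
              rcases lt_trichotomy w a with h | h | h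
              · exact Or.inr ⟨hw, h⟩
              · exact Or.inl h
              · exfalso
                refine hwb.ne (hia (by simp [h.ne', hw]) (by simp [hlt.ne', hb]) ?_)
                exact le_antisymm (θ.toOrderHom.monotone hwb.le)
                  (hab ▸ θ.toOrderHom.monotone h.le)
            · rintro (rfl | ⟨hw, h⟩)
              · exact ⟨ha, hlt⟩
              · exact ⟨hw, h.trans hlt⟩
          unfold vertexSign
          rw [hf, Finset.card_insert_of_notMem (by simp), hv]
          ring
        rw [him, hsign, pow_succ]
        ring
      · have hib : ¬ Set.InjOn θ.toOrderHom
            ((F.erase b : Finset _) : Set (Fin (τ.dim + 1))) :=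
          fun h => hia (hinj b a hb ha hlt.ne' hab.symm h)
        rw [pullback_apply_of_not_injOn _ _ _ hia, pullback_apply_of_not_injOn _ _ _ hib]
        ring
    · intro c hc hne
      rw [pullback_apply_of_not_injOn, mul_zero]
      intro hi
      exact hlt.ne (hi (by simp [hne.1.symm, ha]) (by simp [hne.2.symm, hb]) hab)

theorem pullback_mem_intersectionCochains {τ σ : NerveSimplex P} (θ : τ ⟶ σ) {p : Perversity P}
    {n : ℤ} {ω : Coeffs R σ} (hω : ω ∈ intersectionCochains R p n σ) :
    pullback θ ω ∈ intersectionCochains R p n τ := by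
  refine ⟨⟨pullback_mem_cochains θ hω.1.1, pullback_mem_allowable θ hω.1.2⟩, ?_⟩
  have h := pullback_mem_allowable θ (Submodule.mem_comap.1 hω.2)
  rw [pullback_coboundary] at h
  exact h

theorem pullback_mem_intersectionCocycles {τ σ : NerveSimplex P} (θ : τ ⟶ σ) {p : Perversity P}
    {n : ℤ} {ω : Coeffs R σ} (hω : ω ∈ intersectionCocycles R p n σ) :
    pullback θ ω ∈ intersectionCocycles R p n τ := by
  refine ⟨pullback_mem_intersectionCochains θ hω.1, ?_⟩
  have h : coboundary σ ω = 0 := hω.2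
  change coboundary τ (pullback θ ω) = 0
  rw [← pullback_coboundary, h, map_zero]

theorem coboundary_mem_cochains {σ : NerveSimplex P} {n : ℤ} {ω : Coeffs R σ}
    (hω : ω ∈ cochains R n σ) : coboundary σ ω ∈ cochains R (n + 1) σ := by
  classical
  intro F G h
  rw [coboundary_apply] at h
  by_cases h1 : ∃ v ∈ F, ω (F.erase v) G ≠ 0
  · obtain ⟨v, hv, hne⟩ := h1
    obtain ⟨⟨hr, hl, hs⟩, hd⟩ := hω _ _ hne
    refine ⟨⟨hr, hl, fun t ht => ?_⟩, ?_⟩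
    · obtain ⟨w, hw, rfl⟩ := Finset.mem_image.1 (hs ht)
      exact Finset.mem_image.2 ⟨w, (Finset.mem_erase.1 hw).2, rfl⟩
    · have hc := Finset.card_erase_add_one hv
      unfold faceDim at hd ⊢
      omega
  · by_cases h2 : ∃ s ∈ coned σ F G, ω F (insert s G) ≠ 0
    · obtain ⟨s, hs', hne⟩ := h2
      obtain ⟨⟨hr, hl, hs⟩, hd⟩ := hω _ _ hne
      simp only [coned, Finset.mem_filter, Finset.mem_sdiff] at hs'
      refine ⟨⟨hr, ?_, fun t ht => hs (Finset.mem_insert_of_mem ht)⟩, ?_⟩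
      · rcases Finset.mem_insert.1 hl with h0 | h0
        · exact absurd (h0 ▸ hr) hs'.2
        · exact h0
      · have hc := Finset.card_insert_of_notMem hs'.1.2
        unfold faceDim at hd ⊢
        omega
    · refine absurd ?_ h
      push Not at h1 h2
      rw [Finset.sum_eq_zero fun v hv => by rw [h1 v hv, mul_zero],
        Finset.sum_eq_zero fun s hs => by rw [h2 s hs, mul_zero], add_zero]

theorem sum_sum_erase_eq_zero {α : Type*} [DecidableEq α] (A : Finset α) (f : α → α → R)
    (h : ∀ a ∈ A, ∀ b ∈ A, a ≠ b → f a b + f b a = 0) :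
    ∑ a ∈ A, ∑ b ∈ A.erase a, f a b = 0 := by
  rw [Finset.sum_sigma']
  refine Finset.sum_involution (fun x _ => ⟨x.2, x.1⟩) ?_ ?_ ?_ ?_
  · rintro ⟨a, b⟩ hx
    simp only [Finset.mem_sigma, Finset.mem_erase] at hx
    exact h a hx.1 b hx.2.2 hx.2.1.symm
  · rintro ⟨a, b⟩ hx _ he
    simp only [Finset.mem_sigma, Finset.mem_erase] at hx
    simp only [Sigma.mk.injEq] at he
    exact hx.2.1 he.1
  · rintro ⟨a, b⟩ hx
    simp only [Finset.mem_sigma, Finset.mem_erase] at hx ⊢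
    exact ⟨hx.2.2, hx.2.1.symm, hx.1⟩
  · rintro ⟨a, b⟩ _
    rfl

/-- The differential of the blown up cochains squares to zero. -/
theorem coboundary_coboundary {σ : NerveSimplex P} {n : ℤ} {ω : Coeffs R σ}
    (hω : ω ∈ cochains R n σ) : coboundary σ (coboundary σ ω) = 0 := by
  classical
  funext F G
  rw [coboundary_apply]
  simp only [coboundary_apply, mul_add, Finset.mul_sum, Finset.sum_add_distrib]
  have h1 : ∑ v ∈ F, ∑ w ∈ F.erase v, (-1 : R) ^ vertexSign σ F G v *
      ((-1) ^ vertexSign σ (F.erase v) G w * ω ((F.erase v).erase w) G) = 0 := by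
    refine sum_sum_erase_eq_zero F _ ?_
    have key : ∀ a ∈ F, ∀ b ∈ F, a < b →
        vertexSign σ F G b = vertexSign σ (F.erase a) G b + 1 ∧
        vertexSign σ (F.erase b) G a = vertexSign σ F G a := by
      intro a ha b hb hab
      unfold vertexSign
      have e1 : (F.filter fun w => w < b) = insert a ((F.erase a).filter fun w => w < b) := by
        ext w
        simp only [Finset.mem_filter, Finset.mem_insert, Finset.mem_erase]
        by_cases hw : w = a
        · simp [hw, ha, hab]
        · simp [hw]
      have e2 : ((F.erase b).filter fun w => w < a) = F.filter fun w => w < a := by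
        ext w
        simp only [Finset.mem_filter, Finset.mem_erase]
        constructor
        · rintro ⟨⟨_, h⟩, h'⟩
          exact ⟨h, h'⟩
        · rintro ⟨h, h'⟩
          exact ⟨⟨(h'.trans hab).ne, h⟩, h'⟩
      rw [e1, e2, Finset.card_insert_of_notMem (by simp)]
      exact ⟨by ring, rfl⟩
    have main : ∀ a ∈ F, ∀ b ∈ F, a < b → (-1 : R) ^ vertexSign σ F G a *
        ((-1) ^ vertexSign σ (F.erase a) G b * ω ((F.erase a).erase b) G) +
        (-1 : R) ^ vertexSign σ F G b *
        ((-1) ^ vertexSign σ (F.erase b) G a * ω ((F.erase b).erase a) G) = 0 := by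
      intro a ha b hb hab
      obtain ⟨k1, k2⟩ := key a ha b hb hab
      rw [k1, k2, Finset.erase_right_comm (a := b), pow_succ]
      ring
    intro a ha b hb hab
    rcases lt_or_gt_of_ne hab with h | h
    · exact main a ha b hb h
    · rw [add_comm]
      exact main b hb a ha h
  have h4 : ∑ s ∈ coned σ F G, ∑ t ∈ coned σ F (insert s G), (-1 : R) ^ apexSign σ F G s *
      ((-1) ^ apexSign σ F (insert s G) t * ω F (insert t (insert s G))) = 0 := by
    have hc : ∀ s ∈ coned σ F G, coned σ F (insert s G) = (coned σ F G).erase s := by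
      intro s _
      ext t
      simp only [coned, Finset.mem_filter, Finset.mem_sdiff, Finset.mem_insert,
        Finset.mem_erase]
      tauto
    rw [Finset.sum_congr rfl fun s hs => by rw [hc s hs]]
    refine sum_sum_erase_eq_zero _ (fun s t => (-1 : R) ^ apexSign σ F G s *
      ((-1) ^ apexSign σ F (insert s G) t * ω F (insert t (insert s G)))) ?_
    have main : ∀ a ∈ coned σ F G, ∀ b ∈ coned σ F G, a < b →
        (-1 : R) ^ apexSign σ F G a *
        ((-1) ^ apexSign σ F (insert a G) b * ω F (insert b (insert a G))) +
        (-1 : R) ^ apexSign σ F G b *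
        ((-1) ^ apexSign σ F (insert b G) a * ω F (insert a (insert b G))) = 0 := by
      intro a ha b hb hab
      simp only [coned, Finset.mem_filter, Finset.mem_sdiff] at ha hb
      have k1 : apexSign σ F (insert a G) b = apexSign σ F G b + 1 := by
        unfold apexSign
        rw [Finset.filter_insert, if_pos hab, Finset.card_insert_of_notMem (by simp [ha.1.2])]
        ring
      have k2 : apexSign σ F (insert b G) a = apexSign σ F G a := by
        unfold apexSign
        rw [Finset.filter_insert, if_neg hab.not_gt]
      rw [k1, k2, Finset.insert_comm b a, pow_succ]
      ring
    intro a ha b hb hab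
    have hcmp : a ≤ b ∨ b ≤ a := by
      simp only [coned, Finset.mem_filter, Finset.mem_sdiff, Finset.mem_image] at ha hb
      obtain ⟨⟨⟨v, _, rfl⟩, _⟩, _⟩ := ha
      obtain ⟨⟨⟨w, _, rfl⟩, _⟩, _⟩ := hb
      exact (le_total v w).imp (fun h => σ.vertex.monotone h) fun h => σ.vertex.monotone h
    rcases hcmp with h | h
    · exact main a ha b hb (lt_of_le_of_ne h hab)
    · rw [add_comm]
      exact main b hb a ha (lt_of_le_of_ne h hab.symm)
  have h2 : ∀ v ∈ F, ∑ s ∈ coned σ (F.erase v) G, (-1 : R) ^ vertexSign σ F G v *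
      ((-1) ^ apexSign σ (F.erase v) G s * ω (F.erase v) (insert s G)) =
      ∑ s ∈ coned σ F G, (-1 : R) ^ vertexSign σ F G v *
      ((-1) ^ apexSign σ (F.erase v) G s * ω (F.erase v) (insert s G)) := by
    intro v hv
    refine Finset.sum_subset ?_ ?_
    · intro s hs
      simp only [coned, Finset.mem_filter, Finset.mem_sdiff, Finset.mem_image,
        Finset.mem_erase] at hs ⊢
      obtain ⟨⟨⟨w, hw, hws⟩, hsG⟩, hm⟩ := hs
      exact ⟨⟨⟨w, hw.2, hws⟩, hsG⟩, hm⟩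
    · intro s hs hs'
      have h0 : ω (F.erase v) (insert s G) = 0 := by
        by_contra hne
        have := (hω _ _ hne).1.2.2 (Finset.mem_insert_self s G)
        refine hs' ?_
        simp only [coned, Finset.mem_filter, Finset.mem_sdiff] at hs ⊢
        exact ⟨⟨this, hs.1.2⟩, hs.2⟩
      rw [h0, mul_zero, mul_zero]
  rw [h1, h4, Finset.sum_congr rfl h2, Finset.sum_comm, zero_add, add_zero,
    ← Finset.sum_add_distrib]
  refine Finset.sum_eq_zero fun s hs => ?_
  rw [← Finset.sum_add_distrib]
  refine Finset.sum_eq_zero fun v hv => ?_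
  simp only [coned, Finset.mem_filter, Finset.mem_sdiff, Finset.mem_image] at hs
  obtain ⟨⟨⟨w, hw, hws⟩, hsG⟩, hm⟩ := hs
  have hcmp : σ.vertex v ≤ s ∨ s < σ.vertex v := by
    rw [← hws]
    rcases le_total v w with h | h
    · exact Or.inl (σ.vertex.monotone h)
    · rcases (σ.vertex.monotone h).eq_or_lt with h' | h'
      · exact Or.inl h'.ge
      · exact Or.inr h'
  rcases hcmp with h | h
  · have k1 : apexSign σ F G s = apexSign σ (F.erase v) G s + 1 := by
      unfold apexSign
      have e1 : (F.filter fun w => σ.vertex w ≤ s) =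
          insert v ((F.erase v).filter fun w => σ.vertex w ≤ s) := by
        ext w
        simp only [Finset.mem_filter, Finset.mem_insert, Finset.mem_erase]
        by_cases hw : w = v
        · simp [hw, hv, h]
        · simp [hw]
      rw [e1, Finset.card_insert_of_notMem (by simp)]
      ring
    have k2 : vertexSign σ F (insert s G) v = vertexSign σ F G v := by
      unfold vertexSign
      rw [Finset.filter_insert, if_neg h.not_gt]
    rw [k1, k2, pow_succ]
    ring
  · have k1 : apexSign σ (F.erase v) G s = apexSign σ F G s := by
      unfold apexSign
      have e1 : ((F.erase v).filter fun w => σ.vertex w ≤ s) =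
          F.filter fun w => σ.vertex w ≤ s := by
        ext w
        simp only [Finset.mem_filter, Finset.mem_erase]
        constructor
        · rintro ⟨⟨_, h1⟩, h2⟩
          exact ⟨h1, h2⟩
        · rintro ⟨h1, h2⟩
          exact ⟨⟨fun h3 => h.not_ge (h3 ▸ h2), h1⟩, h2⟩
      rw [e1]
    have k2 : vertexSign σ F (insert s G) v = vertexSign σ F G v + 1 := by
      unfold vertexSign
      rw [Finset.filter_insert, if_pos h, Finset.card_insert_of_notMem (by simp [hsG])]
      ring
    rw [k1, k2, pow_succ]
    ring

theorem coboundary_mem_intersectionCocycles {σ : NerveSimplex P} {p : Perversity P} {n : ℤ}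
    {ω : Coeffs R σ} (hω : ω ∈ intersectionCochains R p n σ) :
    coboundary σ ω ∈ intersectionCocycles R p (n + 1) σ := by
  have h0 := coboundary_coboundary hω.1.1
  refine ⟨⟨⟨coboundary_mem_cochains hω.1.1, hω.2⟩, ?_⟩, h0⟩
  change coboundary σ (coboundary σ ω) ∈ allowable R p σ
  rw [h0]
  exact zero_mem _

end BlowUp

/-! ## Blown up cohomology of simplicial sets over a poset -/

section Cohomology

variable {P : Type u} [PartialOrder P] (R : Type u) [CommRing R]

/-- The module of blown up cochains of `p`-intersection of degree `n` on a simplicial set `L` over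
`P`, that is, of the morphisms of presheaves from `L` to `σ ↦ intersectionCochains R p n σ`:
the families associating to each simplex `x` of `L` over `σ` a cochain of `p`-intersection on
`σ`, compatible with the faces and degeneracies. -/
def blownUpCochains (p : Perversity P) (n : ℤ) (L : SSetOver P) :
    Submodule R (∀ σ : NerveSimplex P, L.obj (op σ) → BlowUp.Coeffs R σ) where
  carrier := {ω | (∀ σ x, ω σ x ∈ BlowUp.intersectionCochains R p n σ) ∧
    ∀ (τ σ : NerveSimplex P) (θ : τ ⟶ σ) (x : L.obj (op σ)),
      ω τ (L.map θ.op x) = BlowUp.pullback θ (ω σ x)}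
  zero_mem' := ⟨fun _ _ => zero_mem _, fun _ _ _ _ => (map_zero _).symm⟩
  add_mem' {ω η} hω hη := by
    refine ⟨fun σ x => add_mem (hω.1 σ x) (hη.1 σ x), fun τ σ θ x => ?_⟩
    simp only [Pi.add_apply, map_add, hω.2 τ σ θ x, hη.2 τ σ θ x]
  smul_mem' a ω hω := by
    refine ⟨fun σ x => Submodule.smul_mem _ a (hω.1 σ x), fun τ σ θ x => ?_⟩
    simp only [Pi.smul_apply, map_smul, hω.2 τ σ θ x]

/-- The differential of the blown up cochains of a simplicial set over `P`. -/
noncomputable def blownUpDifferential (L : SSetOver P) :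
    (∀ σ : NerveSimplex P, L.obj (op σ) → BlowUp.Coeffs R σ) →ₗ[R]
      ∀ σ : NerveSimplex P, L.obj (op σ) → BlowUp.Coeffs R σ where
  toFun ω σ x := BlowUp.coboundary σ (ω σ x)
  map_add' ω η := by
    funext σ x
    simp only [Pi.add_apply, map_add]
  map_smul' a ω := by
    funext σ x
    simp only [Pi.smul_apply, map_smul, RingHom.id_apply]

/-- The module of cocycles of degree `n` of the complex of blown up cochains of
`p`-intersection. -/
noncomputable def blownUpCocycles (p : Perversity P) (n : ℤ) (L : SSetOver P) :
    Submodule R (∀ σ : NerveSimplex P, L.obj (op σ) → BlowUp.Coeffs R σ) :=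
  blownUpCochains R p n L ⊓ LinearMap.ker (blownUpDifferential R L)

/-- The module of coboundaries of degree `n` of the complex of blown up cochains of
`p`-intersection. -/
noncomputable def blownUpCoboundaries (p : Perversity P) (n : ℤ) (L : SSetOver P) :
    Submodule R (∀ σ : NerveSimplex P, L.obj (op σ) → BlowUp.Coeffs R σ) :=
  (blownUpCochains R p (n - 1) L).map (blownUpDifferential R L)

theorem blownUpCoboundaries_le_blownUpCocycles (p : Perversity P) (n : ℤ) (L : SSetOver P) :
    blownUpCoboundaries R p n L ≤ blownUpCocycles R p n L := by
  rintro _ ⟨η, hη, rfl⟩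
  have h : ∀ σ x, BlowUp.coboundary σ (η σ x) ∈ BlowUp.intersectionCocycles R p n σ := by
    intro σ x
    have h0 := BlowUp.coboundary_mem_intersectionCocycles (hη.1 σ x)
    rwa [sub_add_cancel] at h0
  refine ⟨⟨fun σ x => (h σ x).1, fun τ σ θ x => ?_⟩, ?_⟩
  · change BlowUp.coboundary τ (η τ (L.map θ.op x)) = _
    rw [hη.2 τ σ θ x, ← BlowUp.pullback_coboundary]
    rfl
  · funext σ x
    exact (h σ x).2

/-- The blown up intersection cohomology `ℋ^n_p(L; R)`: cocycles modulo coboundaries. -/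
def BlownUpCohomology (p : Perversity P) (n : ℤ) (L : SSetOver P) : Type u :=
  ↥(blownUpCocycles R p n L) ⧸ (blownUpCoboundaries R p n L).submoduleOf (blownUpCocycles R p n L)

noncomputable instance (p : Perversity P) (n : ℤ) (L : SSetOver P) :
    AddCommGroup (BlownUpCohomology R p n L) :=
  inferInstanceAs (AddCommGroup (↥(blownUpCocycles R p n L) ⧸
    (blownUpCoboundaries R p n L).submoduleOf (blownUpCocycles R p n L)))

noncomputable instance (p : Perversity P) (n : ℤ) (L : SSetOver P) :
    Module R (BlownUpCohomology R p n L) :=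
  inferInstanceAs (Module R (↥(blownUpCocycles R p n L) ⧸
    (blownUpCoboundaries R p n L).submoduleOf (blownUpCocycles R p n L)))

variable {R}

/-- The class of a cocycle in the blown up intersection cohomology. -/
noncomputable def blownUpClass {p : Perversity P} {n : ℤ} {L : SSetOver P} :
    ↥(blownUpCocycles R p n L) →ₗ[R] BlownUpCohomology R p n L :=
  Submodule.mkQ ((blownUpCoboundaries R p n L).submoduleOf (blownUpCocycles R p n L))

theorem blownUpClass_surjective {p : Perversity P} {n : ℤ} {L : SSetOver P} :
    Function.Surjective (blownUpClass (R := R) (p := p) (n := n) (L := L)) :=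
  Submodule.mkQ_surjective _

/-- The map `ω ↦ f^* ω`, with `(f^* ω)_x = ω_{f(x)}`, induced by a morphism `f`. -/
def blownUpPullback {L L' : SSetOver P} (f : L ⟶ L') :
    (∀ σ : NerveSimplex P, L'.obj (op σ) → BlowUp.Coeffs R σ) →ₗ[R]
      ∀ σ : NerveSimplex P, L.obj (op σ) → BlowUp.Coeffs R σ where
  toFun ω σ x := ω σ (f.app (op σ) x)
  map_add' _ _ := rfl
  map_smul' _ _ := rfl

theorem blownUpPullback_mem_blownUpCochains {L L' : SSetOver P} (f : L ⟶ L') {p : Perversity P}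
    {n : ℤ} {ω : ∀ σ : NerveSimplex P, L'.obj (op σ) → BlowUp.Coeffs R σ}
    (hω : ω ∈ blownUpCochains R p n L') : blownUpPullback f ω ∈ blownUpCochains R p n L := by
  refine ⟨fun σ x => hω.1 σ _, fun τ σ θ x => ?_⟩
  change ω τ (f.app (op τ) (L.map θ.op x)) = BlowUp.pullback θ (ω σ (f.app (op σ) x))
  rw [NatTrans.naturality_apply f θ.op x, hω.2]

theorem blownUpPullback_mem_blownUpCocycles {L L' : SSetOver P} (f : L ⟶ L') {p : Perversity P}
    {n : ℤ} {ω : ∀ σ : NerveSimplex P, L'.obj (op σ) → BlowUp.Coeffs R σ}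
    (hω : ω ∈ blownUpCocycles R p n L') : blownUpPullback f ω ∈ blownUpCocycles R p n L := by
  refine ⟨blownUpPullback_mem_blownUpCochains f hω.1, ?_⟩
  have h : blownUpDifferential R L' ω = 0 := hω.2
  funext σ x
  exact congrFun (congrFun h σ) (f.app (op σ) x)

/-- The map induced by a morphism on the cocycles. -/
noncomputable def blownUpCocyclesMap {L L' : SSetOver P} (f : L ⟶ L') (p : Perversity P) (n : ℤ) :
    ↥(blownUpCocycles R p n L') →ₗ[R] ↥(blownUpCocycles R p n L) :=
  (blownUpPullback f).restrict fun _ hω => blownUpPullback_mem_blownUpCocycles f hω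

/-- The map induced by a morphism on the blown up intersection cohomology. -/
noncomputable def blownUpCohomologyMap {L L' : SSetOver P} (f : L ⟶ L') (p : Perversity P) (n : ℤ) :
    BlownUpCohomology R p n L' →ₗ[R] BlownUpCohomology R p n L :=
  Submodule.mapQ _ _ (blownUpCocyclesMap f p n) (by
    rintro ⟨ω, hω'⟩ ⟨η, hη, hω⟩
    exact ⟨blownUpPullback f η, blownUpPullback_mem_blownUpCochains f hη, by
      change blownUpPullback f (blownUpDifferential R L' η) = _
      rw [hω]
      rfl⟩)

variable (R)

/-- The blown up intersection cohomology `ℋ^n_p(-; R)`, as a contravariant functor from the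
simplicial sets over `P` to the `R`-modules. -/
noncomputable def blownUpCohomologyFunctor (p : Perversity P) (n : ℤ) :
    (SSetOver P)ᵒᵖ ⥤ ModuleCat.{u} R where
  obj L := ModuleCat.of R (BlownUpCohomology R p n L.unop)
  map f := ModuleCat.ofHom (blownUpCohomologyMap f.unop p n)
  map_id L := by
    ext x
    obtain ⟨ω, rfl⟩ := blownUpClass_surjective x
    rfl
  map_comp f g := by
    ext x
    obtain ⟨ω, rfl⟩ := blownUpClass_surjective x
    rfl

end Cohomology

/-! ## Perverse Eilenberg-MacLane simplicial sets -/

section EilenbergMacLane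

variable {P : Type u} [PartialOrder P] (R : Type u) [CommRing R]

/-- The `p`-perverse Eilenberg-MacLane simplicial set `K(R, n, P, p)`: its simplices over `σ` are the
morphisms to the complex of cochains of `p`-intersection on `σ` from the complex `R(n)` reduced to
a free module on one cocycle of degree `n`, i.e. the cocycles of degree `n` of this complex. -/
noncomputable def perverseEML (p : Perversity P) (n : ℤ) : SSetOver P where
  obj σ := ↥(BlowUp.intersectionCocycles R p n σ.unop)
  map θ := ↾(fun ω => ⟨BlowUp.pullback θ.unop ω.1,
    BlowUp.pullback_mem_intersectionCocycles θ.unop ω.2⟩)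
  map_id σ := by
    ext ω F G
    exact congrFun (congrFun (BlowUp.pullback_id σ.unop (R := R) (Subtype.val ω)) F) G
  map_comp f g := by
    ext ω F G
    exact congrFun (congrFun
      (BlowUp.pullback_comp g.unop f.unop (R := R) (Subtype.val ω)) F) G

variable {R}

/-- A simplex of `K(R, n, P, p)` over `σ`, seen as a cocycle on `σ`. -/
def simplexCocycle {p : Perversity P} {n : ℤ} {σ : NerveSimplex P}
    (x : (perverseEML R p n).obj (op σ)) : ↥(BlowUp.intersectionCocycles R p n σ) := x

/-- The cocycle of degree `n` on `L` given by a morphism from `L` to `K(R, n, P, p)`: it associates to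
a simplex of `L` its image, which is a cocycle. -/
noncomputable def cocycleOfHom {p : Perversity P} {n : ℤ} {L : SSetOver P}
    (f : L ⟶ perverseEML R p n) : ↥(blownUpCocycles R p n L) :=
  ⟨fun σ x => (simplexCocycle (f.app (op σ) x)).1,
    ⟨fun _ x => (simplexCocycle (f.app _ x)).2.1,
      fun _ _ θ x => congrArg (fun y => (simplexCocycle y).1) (NatTrans.naturality_apply f θ.op x)⟩,
    funext fun _ => funext fun x => (simplexCocycle (f.app _ x)).2.2⟩

variable (R) in
/-- The fundamental class of `K(R, n, P, p)`, in its blown up cohomology of degree `n` for the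
perversity `p`: the class of the tautological cocycle. -/
noncomputable def fundamentalClass (p : Perversity P) (n : ℤ) :
    BlownUpCohomology R p n (perverseEML R p n) :=
  blownUpClass (cocycleOfHom (𝟙 (perverseEML R p n)))

end EilenbergMacLane

/-! ## Perverse cohomological operations -/

section Operations

variable {P : Type u} [PartialOrder P] (R : Type u) [CommRing R]

/-- The perverse cohomological operations of type `(p, n, q, m)`: the natural transformations, as
functors with values in sets, from `ℋ^n_p(-; R)` to `ℋ^m_q(-; R)`. An operation does not have to
be additive. -/
def PerverseOperation (p : Perversity P) (n : ℤ) (q : Perversity P) (m : ℤ) : Type (u + 1) :=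
  (blownUpCohomologyFunctor R p n ⋙ forget (ModuleCat.{u} R)) ⟶
    (blownUpCohomologyFunctor R q m ⋙ forget (ModuleCat.{u} R))

namespace PerverseOperation

variable {R} {p : Perversity P} {n : ℤ} {q : Perversity P} {m : ℤ}

/-- The value of an operation on a cohomology class of `L`. -/
def eval (θ : PerverseOperation R p n q m) (L : SSetOver P) (x : BlownUpCohomology R p n L) :
    BlownUpCohomology R q m L :=
  NatTrans.app θ (op L) x

variable (R p n q m) in
/-- The module of the families of maps, from `ℋ^n_p(L; R)` to `ℋ^m_q(L; R)`, which are natural in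
`L`, with the pointwise operations. -/
noncomputable def naturalFamilies :
    Submodule R (∀ L : SSetOver P, BlownUpCohomology R p n L → BlownUpCohomology R q m L) where
  carrier := {θ | ∀ (L L' : SSetOver P) (f : L ⟶ L') (x : BlownUpCohomology R p n L'),
    θ L (blownUpCohomologyMap (R := R) f p n x) =
      blownUpCohomologyMap (R := R) f q m (θ L' x)}
  zero_mem' _ _ _ _ := (map_zero _).symm
  add_mem' {θ θ'} hθ hθ' L L' f x := by
    simp only [Pi.add_apply, map_add, hθ L L' f x, hθ' L L' f x]
  smul_mem' a θ hθ L L' f x := by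
    simp only [Pi.smul_apply, map_smul, hθ L L' f x]

variable (R p n q m) in
/-- Operations are the same as natural families of maps. -/
noncomputable def equivNaturalFamilies :
    PerverseOperation R p n q m ≃ ↥(naturalFamilies R p n q m) where
  toFun θ := ⟨θ.eval, fun _ _ f x => NatTrans.naturality_apply θ f.op x⟩
  invFun θ :=
    { app := fun L => ↾(θ.1 L.unop)
      naturality := fun L L' f => by
        ext x
        exact θ.2 L'.unop L.unop f.unop x }
  left_inv _ := rfl
  right_inv _ := rfl

/-- The operations form a group for the pointwise addition. -/
noncomputable instance : AddCommGroup (PerverseOperation R p n q m) :=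
  (equivNaturalFamilies R p n q m).addCommGroup

/-- The operations form a module for the pointwise addition and scalar multiplication. -/
noncomputable instance : Module R (PerverseOperation R p n q m) :=
  (equivNaturalFamilies R p n q m).module R

end PerverseOperation

end Operations

/-! The presheaf `perverseEML R p n` represents cocycles: `cocycleOfHom` and `homOfCocycle` identify
morphisms from `L` to it with `n`-cocycles of `L`. The heart of the matter is that two such
morphisms are homotopic exactly when their cocycles are cohomologous (`strictlyHomotopic_iff`), so
that homotopy classes are cohomology classes. The rest is the Yoneda lemma. Since `⟨g⟩` is the
pullback along `g` of the fundamental class, naturality determines an operation by its value on that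
class; conversely every class on `perverseEML R p n` is some `⟨f⟩`, and `⟨g⟩ ↦ ⟨g ≫ f⟩` is a well
defined operation because postcomposition preserves homotopies.

Cohomologous implies homotopic: if `δη = g - f`, extend `η` by zero from the end `1` to a cochain
`η'` on `L ⊗ Δ[1]`; then the pullback of `f` plus `δη'` is a cocycle on the cylinder, hence a
homotopy from `f` to `g`. What has to be verified is that the extension respects the perversity
(`cutoff_mem_intersectionCochains`).

Homotopic implies cohomologous: the prism `σ × Δ[1]` is cut into the simplices `σ.double c`, one for
each vertex `c` of `σ`. The signed sum of the values of a cocycle over them is a cochain on `L`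
whose differential is the difference of the two ends (`coboundary_prism`), the inner walls
cancelling in pairs. Perversity conditions survive because a face of `σ` has perverse degree at most
that of each prism face over it (`prism_mem_allowable`). -/

namespace BlowUp

/-! ### Cutting off blown up cochains. -/

variable {P : Type u} [PartialOrder P] {R : Type u} [CommRing R]

open scoped Classical in
/-- The product of a blown up cochain on `σ` with the function which is the indicator of
the faces all of whose vertices are sent to `1` by `χ`. -/
noncomputable def cutoff {σ : NerveSimplex P} (χ : Fin (σ.dim + 1) →o Fin 2) (ω : Coeffs R σ) :
    Coeffs R σ :=
  fun F G => if ∀ v ∈ F, χ v = 1 then ω F G else 0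

theorem cutoff_apply_of_forall {σ : NerveSimplex P} {χ : Fin (σ.dim + 1) →o Fin 2}
    (ω : Coeffs R σ) {F : Finset (Fin (σ.dim + 1))} (G : Finset P) (h : ∀ v ∈ F, χ v = 1) :
    cutoff χ ω F G = ω F G := if_pos h

theorem cutoff_apply_of_not_forall {σ : NerveSimplex P} {χ : Fin (σ.dim + 1) →o Fin 2}
    (ω : Coeffs R σ) {F : Finset (Fin (σ.dim + 1))} (G : Finset P) (h : ¬ ∀ v ∈ F, χ v = 1) :
    cutoff χ ω F G = 0 := if_neg h

theorem apply_ne_zero_of_cutoff_ne_zero {σ : NerveSimplex P} {χ : Fin (σ.dim + 1) →o Fin 2}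
    {ω : Coeffs R σ} {F : Finset (Fin (σ.dim + 1))} {G : Finset P} (h : cutoff χ ω F G ≠ 0) :
    (∀ v ∈ F, χ v = 1) ∧ ω F G ≠ 0 := by
  by_cases hF : ∀ v ∈ F, χ v = 1
  · exact ⟨hF, by rwa [cutoff_apply_of_forall _ _ hF] at h⟩
  · exact absurd (cutoff_apply_of_not_forall _ _ hF) h

theorem pullback_cutoff {τ σ : NerveSimplex P} (θ : τ ⟶ σ) (χ : Fin (σ.dim + 1) →o Fin 2)
    (ω : Coeffs R σ) :
    pullback θ (cutoff χ ω) = cutoff (χ.comp θ.toOrderHom) (pullback θ ω) := by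
  classical
  funext F G
  by_cases hθ : Set.InjOn θ.toOrderHom (F : Set (Fin (τ.dim + 1)))
  · rw [pullback_apply_of_injOn _ _ _ hθ]
    unfold cutoff
    rw [pullback_apply_of_injOn _ _ _ hθ]
    simp
  · rw [pullback_apply_of_not_injOn _ _ _ hθ]
    unfold cutoff
    rw [pullback_apply_of_not_injOn _ _ _ hθ, ite_self]

theorem cutoff_const_one {σ : NerveSimplex P} (ω : Coeffs R σ) :
    cutoff (OrderHom.const _ 1) ω = ω := by
  funext F G
  exact cutoff_apply_of_forall _ _ fun _ _ => rfl

/-- A face has at least one vertex, over the last stratum, which always belongs to `G`. For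
coefficients supported on faces the condition on the vertices is therefore never vacuous. -/
theorem cutoff_const_zero {σ : NerveSimplex P} {n : ℤ} {ω : Coeffs R σ}
    (hω : ω ∈ cochains R n σ) : cutoff (OrderHom.const _ 0) ω = 0 := by
  classical
  funext F G
  by_contra h
  obtain ⟨h1, h2⟩ := apply_ne_zero_of_cutoff_ne_zero h
  obtain ⟨_, hl, hs⟩ := (hω F G h2).1
  obtain ⟨v, hv, _⟩ := Finset.mem_image.1 (hs hl)
  exact zero_ne_one (h1 v hv)

/-- Where all vertices of the face are sent to `1`, the differentials of `ω` and of its cutoff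
agree. Elsewhere, the differential of the cutoff can only come from adding a new first vertex to a
face in the support of `ω`, and perverse degrees do not see such a vertex. Cutting off towards the
end `1` matters: a new last vertex could raise perverse degrees. -/
theorem cutoff_mem_intersectionCochains {σ : NerveSimplex P} (χ : Fin (σ.dim + 1) →o Fin 2)
    {p : Perversity P} {n : ℤ} {ω : Coeffs R σ} (hω : ω ∈ intersectionCochains R p n σ) :
    cutoff χ ω ∈ intersectionCochains R p n σ := by
  classical
  refine ⟨⟨fun F G h => hω.1.1 F G (apply_ne_zero_of_cutoff_ne_zero h).2,
    fun F G h => hω.1.2 F G (apply_ne_zero_of_cutoff_ne_zero h).2⟩, fun F G h s => ?_⟩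
  by_cases hF : ∀ v ∈ F, χ v = 1
  · refine hω.2 F G ?_ s
    convert h using 1
    rw [coboundary_apply, coboundary_apply]
    congr 1
    · refine Finset.sum_congr rfl fun v _ => ?_
      rw [cutoff_apply_of_forall _ _ fun w hw => hF w (Finset.mem_of_mem_erase hw)]
    · refine Finset.sum_congr rfl fun s _ => ?_
      rw [cutoff_apply_of_forall _ _ hF]
  · rw [coboundary_apply, Finset.sum_eq_zero (s := coned σ F G) fun s _ => by
      rw [cutoff_apply_of_not_forall _ _ hF, mul_zero], add_zero] at h
    obtain ⟨v, hv, hne⟩ := Finset.exists_ne_zero_of_sum_ne_zero h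
    obtain ⟨h1, h2⟩ := apply_ne_zero_of_cutoff_ne_zero (right_ne_zero_of_mul hne)
    -- The removed vertex is the only one sent to `0`.
    have hv1 : χ v ≠ 1 := fun hv1 => hF fun w hw => by
      by_cases hwv : w = v
      · rw [hwv, hv1]
      · exact h1 w (Finset.mem_erase.2 ⟨hwv, hw⟩)
    have hp := hω.1.2 _ _ h2 s
    unfold perverseDegree at hp ⊢
    by_cases hs : s ∈ G
    · rw [if_pos hs] at hp ⊢
      -- If `v` lay strictly above `s`, then `s` would be the stratum of some other vertex `a < v`
      -- of the face; as `χ a = 1`, monotonicity would force `χ v = 1`.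
      have hf : (F.filter fun w => s < σ.vertex w) =
          (F.erase v).filter fun w => s < σ.vertex w := by
        ext w
        simp only [Finset.mem_filter, Finset.mem_erase]
        refine ⟨fun hw => ⟨⟨?_, hw.1⟩, hw.2⟩, fun hw => ⟨hw.1.2, hw.2⟩⟩
        rintro rfl
        obtain ⟨a, ha, rfl⟩ := Finset.mem_image.1 ((hω.1.1 _ _ h2).1.2.2 hs)
        have hlt : a < w := lt_of_not_ge fun hwa => hw.2.not_ge (σ.vertex.monotone hwa)
        have := χ.monotone hlt.le
        rw [h1 a ha] at this
        exact hv1 (le_antisymm (Fin.le_last _) this)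
      rwa [hf]
    · rw [if_neg hs]
      exact bot_le

end BlowUp

/-! ### Cohomologous cocycles give homotopic morphisms. -/

namespace SSetOver

variable {P : Type u} [PartialOrder P]

/-- The projection `L ⊗ Δ[1] → L`. -/
def cylinderProjection (L : SSetOver P) : cylinder L ⟶ L where
  app _ := ↾(fun x => x.1)
  naturality _ _ _ := rfl

end SSetOver

section Cohomology

variable {P : Type u} [PartialOrder P] {R : Type u} [CommRing R]

/-- The morphism to `K(R, n, P, p)` given by a cocycle. -/
noncomputable def homOfCocycle {p : Perversity P} {n : ℤ} {L : SSetOver P}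
    (ω : ↥(blownUpCocycles R p n L)) : L ⟶ perverseEML R p n where
  app σ := ↾(fun x => ⟨ω.1 σ.unop x, ω.2.1.1 σ.unop x, congrFun (congrFun ω.2.2 σ.unop) x⟩)
  naturality σ τ θ := by
    ext x
    exact Subtype.ext (ω.2.1.2 τ.unop σ.unop θ.unop x)

theorem cocycleOfHom_injective {p : Perversity P} {n : ℤ} {L : SSetOver P} :
    Function.Injective (cocycleOfHom : (L ⟶ perverseEML R p n) → ↥(blownUpCocycles R p n L)) := by
  intro f g h
  ext σ x
  exact Subtype.ext (congrFun (congrFun (congrArg Subtype.val h) σ.unop) x)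

theorem blownUpCocyclesMap_cocycleOfHom {p : Perversity P} {n : ℤ} {L L' : SSetOver P}
    (g : L ⟶ L') (f : L' ⟶ perverseEML R p n) :
    blownUpCocyclesMap g p n (cocycleOfHom f) = cocycleOfHom (g ≫ f) := rfl

theorem blownUpCohomologyMap_blownUpClass {p : Perversity P} {n : ℤ} {L L' : SSetOver P}
    (g : L ⟶ L') (ω : ↥(blownUpCocycles R p n L')) :
    blownUpCohomologyMap g p n (blownUpClass ω) = blownUpClass (blownUpCocyclesMap g p n ω) := rfl

theorem blownUpClass_eq_iff {p : Perversity P} {n : ℤ} {L : SSetOver P}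
    {ω ω' : ↥(blownUpCocycles R p n L)} :
    blownUpClass ω = blownUpClass ω' ↔
      ∃ η ∈ blownUpCochains R p (n - 1) L, blownUpDifferential R L η = ω.1 - ω'.1 :=
  Submodule.Quotient.eq _

/-- The cochain on `L ⊗ Δ[1]` extending by zero over the end `0` a cochain on the end `1`. -/
noncomputable def cylinderCutoff (L : SSetOver P)
    (η : ∀ σ : NerveSimplex P, L.obj (op σ) → BlowUp.Coeffs R σ) :
    ∀ σ : NerveSimplex P, (SSetOver.cylinder L).obj (op σ) → BlowUp.Coeffs R σ :=
  fun σ x => BlowUp.cutoff x.2 (η σ x.1)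

theorem cylinderCutoff_mem_blownUpCochains {p : Perversity P} {n : ℤ} {L : SSetOver P}
    {η : ∀ σ : NerveSimplex P, L.obj (op σ) → BlowUp.Coeffs R σ}
    (hη : η ∈ blownUpCochains R p n L) :
    cylinderCutoff L η ∈ blownUpCochains R p n (SSetOver.cylinder L) := by
  refine ⟨fun σ x => BlowUp.cutoff_mem_intersectionCochains _ (hη.1 σ _), fun τ σ θ x => ?_⟩
  change BlowUp.cutoff (x.2.comp θ.toOrderHom) (η τ (L.map θ.op x.1)) =
    BlowUp.pullback θ (BlowUp.cutoff x.2 (η σ x.1))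
  rw [hη.2, BlowUp.pullback_cutoff]

theorem strictlyHomotopic_of_blownUpClass_eq {p : Perversity P} {n : ℤ} {L : SSetOver P}
    {f g : L ⟶ perverseEML R p n}
    (h : blownUpClass (cocycleOfHom g) = blownUpClass (cocycleOfHom f)) :
    SSetOver.StrictlyHomotopic f g := by
  obtain ⟨η, hη, hd⟩ := blownUpClass_eq_iff.1 h
  have hmem : blownUpDifferential R _ (cylinderCutoff L η) ∈
      blownUpCocycles R p n (SSetOver.cylinder L) :=
    blownUpCoboundaries_le_blownUpCocycles _ _ _ _
      ⟨_, cylinderCutoff_mem_blownUpCochains hη, rfl⟩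
  -- The added coboundary restricts to `0` on the end `0` and to `δη = g - f` on the end `1`.
  refine ⟨homOfCocycle (cocycleOfHom (SSetOver.cylinderProjection L ≫ f) + ⟨_, hmem⟩), ?_, ?_⟩
  · refine cocycleOfHom_injective (Subtype.ext ?_)
    funext σ x
    change (cocycleOfHom f).1 σ x +
      BlowUp.coboundary σ (BlowUp.cutoff (OrderHom.const _ 0) (η σ x)) = (cocycleOfHom f).1 σ x
    rw [BlowUp.cutoff_const_zero (hη.1 σ x).1.1, map_zero, add_zero]
  · refine cocycleOfHom_injective (Subtype.ext ?_)
    funext σ x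
    change (cocycleOfHom f).1 σ x +
      BlowUp.coboundary σ (BlowUp.cutoff (OrderHom.const _ 1) (η σ x)) = (cocycleOfHom g).1 σ x
    rw [BlowUp.cutoff_const_one]
    have := congrFun (congrFun hd σ) x
    change BlowUp.coboundary σ (η σ x) = (cocycleOfHom g).1 σ x - (cocycleOfHom f).1 σ x at this
    rw [this]
    abel

end Cohomology

/-! ### Combinatorics of the prism over a simplex. -/

section Fin

variable {n : ℕ}

theorem Fin.predAbove_succ_succAbove (c i : Fin n) : c.predAbove (c.succ.succAbove i) = i := by
  rcases le_or_gt i c with h | h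
  · rw [Fin.succAbove_succ_of_le _ _ h, Fin.predAbove_castSucc_of_le _ _ h]
  · rw [Fin.succAbove_succ_of_lt _ _ h, Fin.predAbove_succ_of_le _ _ h.le]

/-- These are the lower and the upper vertices of the prism simplex at `c`. Both descriptions allow
`u = c`, which accounts for the two copies of `c`. -/
theorem Fin.eq_castSucc_or_eq_succ (c : Fin n) (i : Fin (n + 1)) :
    (∃ u ≤ c, i = u.castSucc) ∨ ∃ u, c ≤ u ∧ i = u.succ := by
  rcases le_or_gt i c.castSucc with h | h
  · refine Or.inl ⟨i.castPred (Fin.ne_last_of_lt (lt_of_le_of_lt h (Fin.castSucc_lt_last c))), ?_, ?_⟩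
    · rwa [Fin.castPred_le_iff]
    · simp
  · refine Or.inr ⟨i.pred (Fin.ne_zero_of_lt h), ?_, ?_⟩
    · rw [Fin.le_pred_iff]
      exact Fin.castSucc_lt_iff_succ_le.1 h
    · simp

end Fin

namespace NerveSimplex

variable {P : Type u} [PartialOrder P]

/-- The degeneracy of the simplex `σ` which doubles the vertex `c`. -/
abbrev double (σ : NerveSimplex P) (c : Fin (σ.dim + 1)) : NerveSimplex P where
  dim := σ.dim + 1
  vertex := σ.vertex.comp c.predAboveOrderHom

theorem double_vertex (σ : NerveSimplex P) (c : Fin (σ.dim + 1)) (i : Fin (σ.dim + 2)) :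
    (σ.double c).vertex i = σ.vertex (c.predAbove i) := rfl

/-- The morphism identifying the two copies of the vertex `c`. -/
def collapse (σ : NerveSimplex P) (c : Fin (σ.dim + 1)) : σ.double c ⟶ σ :=
  ⟨c.predAboveOrderHom, fun _ => rfl⟩

/-- The map `[dim + 1] → [1]` which separates the two copies of the vertex `c`. -/
def doubleCut (σ : NerveSimplex P) (c : Fin (σ.dim + 1)) : Fin ((σ.double c).dim + 1) →o Fin 2 where
  toFun (i : Fin (σ.dim + 2)) := if c.castSucc < i then 1 else 0
  monotone' := by
    intro (i : Fin (σ.dim + 2)) (j : Fin (σ.dim + 2)) hij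
    change (if c.castSucc < i then (1 : Fin 2) else 0) ≤ if c.castSucc < j then 1 else 0
    by_cases h : c.castSucc < i
    · rw [if_pos h, if_pos (h.trans_le hij)]
    · rw [if_neg h]
      exact Fin.zero_le _

/-- The map `[dim] → [1]` sending the vertices from the `k`-th one on to `1`. -/
def cut (σ : NerveSimplex P) (k : Fin (σ.dim + 2)) : Fin (σ.dim + 1) →o Fin 2 where
  toFun i := if k ≤ i.castSucc then 1 else 0
  monotone' := by
    intro i j hij
    by_cases h : k ≤ i.castSucc
    · simp only [if_pos h, if_pos (h.trans (Fin.castSucc_le_castSucc_iff.2 hij)), le_refl]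
    · simp only [if_neg h]
      exact Fin.zero_le _

/-- The maps `σ.cut k` are the copies of `σ` separating consecutive simplices of the prism. The
order is reversed: `k = 0` is the end `1` and the last `k` is the end `0`. -/
theorem cut_zero (σ : NerveSimplex P) : σ.cut 0 = OrderHom.const _ 1 := by
  ext i
  simp [cut]

theorem cut_last (σ : NerveSimplex P) : σ.cut (Fin.last _) = OrderHom.const _ 0 := by
  ext i
  simp [cut]

/-- The face of the simplex `σ.double c` forgetting one of the two copies of the vertex `c`. -/
def coface (σ : NerveSimplex P) (c : Fin (σ.dim + 1)) (k : Fin (σ.dim + 2))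
    (hk : ∀ i, c.predAbove (k.succAbove i) = i) : σ ⟶ σ.double c :=
  ⟨k.succAboveOrderEmb.toOrderHom, fun i => congrArg σ.vertex (hk i)⟩

theorem coface_apply (σ : NerveSimplex P) (c : Fin (σ.dim + 1)) (k : Fin (σ.dim + 2))
    (hk : ∀ i, c.predAbove (k.succAbove i) = i) (i : Fin (σ.dim + 1)) :
    (σ.coface c k hk).toOrderHom i = k.succAbove i := rfl

theorem coface_injective (σ : NerveSimplex P) (c : Fin (σ.dim + 1)) (k : Fin (σ.dim + 2))
    (hk : ∀ i, c.predAbove (k.succAbove i) = i) :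
    Function.Injective (σ.coface c k hk).toOrderHom :=
  k.succAbove_right_injective

theorem coface_collapse (σ : NerveSimplex P) (c : Fin (σ.dim + 1)) (k : Fin (σ.dim + 2))
    (hk : ∀ i, c.predAbove (k.succAbove i) = i) : σ.coface c k hk ≫ σ.collapse c = 𝟙 σ :=
  Hom.ext (OrderHom.ext _ _ (funext hk))

/-- With the next lemma, this identifies the two walls of the prism simplex at `c`: the upper index
`c.succ` is the lower index for the next vertex, so neighbouring simplices share a wall and a sum
over `c` telescopes. -/
theorem doubleCut_comp_coface_castSucc (σ : NerveSimplex P) (c : Fin (σ.dim + 1)) :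
    (σ.doubleCut c).comp (σ.coface c c.castSucc c.predAbove_succAbove).toOrderHom =
      σ.cut c.castSucc := by
  refine OrderHom.ext _ _ (funext fun i => ?_)
  change (if c.castSucc < c.castSucc.succAbove i then (1 : Fin 2) else 0) =
    if c.castSucc ≤ i.castSucc then 1 else 0
  simp only [Fin.lt_succAbove_iff_le_castSucc]

theorem doubleCut_comp_coface_succ (σ : NerveSimplex P) (c : Fin (σ.dim + 1)) :
    (σ.doubleCut c).comp (σ.coface c c.succ c.predAbove_succ_succAbove).toOrderHom =
      σ.cut c.succ := by
  refine OrderHom.ext _ _ (funext fun i => ?_)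
  change (if c.castSucc < c.succ.succAbove i then (1 : Fin 2) else 0) =
    if c.succ ≤ i.castSucc then 1 else 0
  rcases le_or_gt i c with h | h
  · rw [Fin.succAbove_succ_of_le _ _ h, if_neg, if_neg]
    · simpa using h
    · simpa using h
  · rw [Fin.succAbove_succ_of_lt _ _ h, if_pos, if_pos]
    · simpa using h
    · exact Fin.castSucc_lt_succ_iff.2 h.le

/-- The morphism induced by `θ` on the degeneracies doubling `c` and its image by `θ`. -/
def doubleMap {τ σ : NerveSimplex P} (θ : τ ⟶ σ) (c : Fin (τ.dim + 1)) :
    τ.double c ⟶ σ.double (θ.toOrderHom c) where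
  toOrderHom :=
    { toFun := fun i : Fin (τ.dim + 2) => if c.castSucc < i then (θ.toOrderHom (c.predAbove i)).succ
        else (θ.toOrderHom (c.predAbove i)).castSucc
      monotone' := by
        intro (i : Fin (τ.dim + 2)) (j : Fin (τ.dim + 2)) hij
        have h := θ.toOrderHom.monotone (Fin.predAbove_right_monotone c hij)
        dsimp only
        split_ifs with h1 h2 h2
        · exact Fin.succ_le_succ_iff.2 h
        · exact absurd (h1.trans_le hij) h2
        · exact (Fin.castSucc_le_castSucc_iff.2 h).trans (Fin.castSucc_le_succ _)
        · exact Fin.castSucc_le_castSucc_iff.2 h }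
  comm := by
    intro (i : Fin (τ.dim + 2))
    rw [double_vertex, double_vertex, ← θ.comm]
    congr 1
    change (θ.toOrderHom c).predAbove (if c.castSucc < i then _ else _) = _
    rcases c.eq_castSucc_or_eq_succ i with ⟨u, hu, rfl⟩ | ⟨u, hu, rfl⟩
    · rw [if_neg (by simpa using hu), Fin.predAbove_castSucc_of_le _ _ hu,
        Fin.predAbove_castSucc_of_le _ _ (θ.toOrderHom.monotone hu)]
    · rw [if_pos (Fin.castSucc_lt_succ_iff.2 hu), Fin.predAbove_succ_of_le _ _ hu,
        Fin.predAbove_succ_of_le _ _ (θ.toOrderHom.monotone hu)]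

theorem doubleMap_castSucc {τ σ : NerveSimplex P} (θ : τ ⟶ σ) {c u : Fin (τ.dim + 1)}
    (h : u ≤ c) : (doubleMap θ c).toOrderHom u.castSucc = (θ.toOrderHom u).castSucc := by
  change (if c.castSucc < u.castSucc then _ else _) = _
  rw [if_neg (by simpa using h), Fin.predAbove_castSucc_of_le _ _ h]

theorem doubleMap_succ {τ σ : NerveSimplex P} (θ : τ ⟶ σ) {c u : Fin (τ.dim + 1)}
    (h : c ≤ u) : (doubleMap θ c).toOrderHom u.succ = (θ.toOrderHom u).succ := by
  change (if c.castSucc < u.succ then _ else _) = _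
  rw [if_pos (Fin.castSucc_lt_succ_iff.2 h), Fin.predAbove_succ_of_le _ _ h]

theorem predAbove_doubleMap {τ σ : NerveSimplex P} (θ : τ ⟶ σ) (c : Fin (τ.dim + 1))
    (i : Fin (τ.dim + 2)) :
    (θ.toOrderHom c).predAbove ((doubleMap θ c).toOrderHom i) =
      θ.toOrderHom (c.predAbove i) := by
  rcases c.eq_castSucc_or_eq_succ i with ⟨u, hu, rfl⟩ | ⟨u, hu, rfl⟩
  · rw [doubleMap_castSucc θ hu, Fin.predAbove_castSucc_of_le _ _ hu,
      Fin.predAbove_castSucc_of_le _ _ (θ.toOrderHom.monotone hu)]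
  · rw [doubleMap_succ θ hu, Fin.predAbove_succ_of_le _ _ hu,
      Fin.predAbove_succ_of_le _ _ (θ.toOrderHom.monotone hu)]

theorem doubleMap_collapse {τ σ : NerveSimplex P} (θ : τ ⟶ σ) (c : Fin (τ.dim + 1)) :
    doubleMap θ c ≫ σ.collapse (θ.toOrderHom c) = τ.collapse c ≫ θ :=
  Hom.ext (OrderHom.ext _ _ (funext (predAbove_doubleMap θ c)))

theorem doubleCut_comp_doubleMap {τ σ : NerveSimplex P} (θ : τ ⟶ σ) (c : Fin (τ.dim + 1)) :
    (σ.doubleCut (θ.toOrderHom c)).comp (doubleMap θ c).toOrderHom = τ.doubleCut c := by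
  refine OrderHom.ext _ _ (funext fun (i : Fin (τ.dim + 2)) => ?_)
  change (if (θ.toOrderHom c).castSucc < (doubleMap θ c).toOrderHom i then (1 : Fin 2) else 0) =
    if c.castSucc < i then 1 else 0
  rcases c.eq_castSucc_or_eq_succ i with ⟨u, hu, rfl⟩ | ⟨u, hu, rfl⟩
  · rw [doubleMap_castSucc θ hu, if_neg, if_neg]
    · simpa using hu
    · simpa using θ.toOrderHom.monotone hu
  · rw [doubleMap_succ θ hu, if_pos, if_pos]
    · exact Fin.castSucc_lt_succ_iff.2 hu
    · exact Fin.castSucc_lt_succ_iff.2 (θ.toOrderHom.monotone hu)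

/-- The set of the vertices of `σ.double c` which are copies of elements of `F`. -/
def doubleFace {σ : NerveSimplex P} (c : Fin (σ.dim + 1)) (F : Finset (Fin (σ.dim + 1))) :
    Finset (Fin ((σ.double c).dim + 1)) :=
  Finset.univ.filter fun i : Fin (σ.dim + 2) => c.predAbove i ∈ F

theorem mem_doubleFace {σ : NerveSimplex P} {c : Fin (σ.dim + 1)} {F : Finset (Fin (σ.dim + 1))}
    {i : Fin ((σ.double c).dim + 1)} :
    i ∈ doubleFace c F ↔ Fin.predAbove (n := σ.dim + 1) c i ∈ F := by
  simp only [doubleFace, Finset.mem_filter]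
  exact and_iff_right (Finset.mem_univ i)

theorem image_coface {σ : NerveSimplex P} (c : Fin (σ.dim + 1)) (k : Fin (σ.dim + 2))
    (hk : ∀ i, c.predAbove (k.succAbove i) = i) (F : Finset (Fin (σ.dim + 1))) :
    F.image (σ.coface c k hk).toOrderHom = (doubleFace c F).erase k := by
  ext i
  simp only [Finset.mem_image, Finset.mem_erase, mem_doubleFace, coface_apply]
  constructor
  · rintro ⟨u, hu, rfl⟩
    exact ⟨Fin.succAbove_ne k u, by rwa [hk]⟩
  · rintro ⟨hi, hF⟩
    obtain ⟨u, rfl⟩ := Fin.exists_succAbove_eq hi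
    exact ⟨u, by rwa [hk] at hF, rfl⟩

theorem castSucc_mem_doubleFace {σ : NerveSimplex P} {c u : Fin (σ.dim + 1)}
    {F : Finset (Fin (σ.dim + 1))} (h : u ≤ c) :
    (u.castSucc : Fin (σ.dim + 2)) ∈ doubleFace c F ↔ u ∈ F := by
  rw [mem_doubleFace, Fin.predAbove_castSucc_of_le _ _ h]

theorem succ_mem_doubleFace {σ : NerveSimplex P} {c u : Fin (σ.dim + 1)}
    {F : Finset (Fin (σ.dim + 1))} (h : c ≤ u) :
    (u.succ : Fin (σ.dim + 2)) ∈ doubleFace c F ↔ u ∈ F := by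
  rw [mem_doubleFace, Fin.predAbove_succ_of_le _ _ h]

theorem card_doubleFace {σ : NerveSimplex P} {c : Fin (σ.dim + 1)}
    {F : Finset (Fin (σ.dim + 1))} (hc : c ∈ F) : (doubleFace c F).card = F.card + 1 := by
  rw [← Finset.card_erase_add_one ((castSucc_mem_doubleFace le_rfl).2 hc),
    ← image_coface c c.castSucc c.predAbove_succAbove,
    Finset.card_image_of_injective _ (coface_injective _ _ _ _)]

open scoped Classical in
theorem image_vertex_doubleFace {σ : NerveSimplex P} (c : Fin (σ.dim + 1))
    (F : Finset (Fin (σ.dim + 1))) :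
    (doubleFace c F).image (σ.double c).vertex = F.image σ.vertex := by
  ext s
  simp only [Finset.mem_image, mem_doubleFace]
  constructor
  · rintro ⟨i, hi, rfl⟩
    exact ⟨_, hi, rfl⟩
  · rintro ⟨u, hu, rfl⟩
    refine ⟨c.castSucc.succAbove u, ?_, ?_⟩
    · rwa [c.predAbove_succAbove]
    · rw [double_vertex, c.predAbove_succAbove]

/-- Needed because `pullback` vanishes on faces that become degenerate: a face and its double must
degenerate together. -/
theorem injOn_doubleMap_iff {τ σ : NerveSimplex P} (θ : τ ⟶ σ) {c : Fin (τ.dim + 1)}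
    {F : Finset (Fin (τ.dim + 1))} (hc : c ∈ F) :
    Set.InjOn (doubleMap θ c).toOrderHom (doubleFace c F : Set (Fin ((τ.double c).dim + 1))) ↔
      Set.InjOn θ.toOrderHom (F : Set (Fin (τ.dim + 1))) := by
  constructor
  · intro h
    have low : ∀ a ∈ F, ∀ b ∈ F, a ≤ c → b ≤ c → θ.toOrderHom a = θ.toOrderHom b → a = b := by
      intro a ha b hb hac hbc hab
      refine Fin.castSucc_injective _ (h ((castSucc_mem_doubleFace hac).2 ha)
        ((castSucc_mem_doubleFace hbc).2 hb) ?_)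
      rw [doubleMap_castSucc θ hac, doubleMap_castSucc θ hbc, hab]
    have high : ∀ a ∈ F, ∀ b ∈ F, c ≤ a → c ≤ b → θ.toOrderHom a = θ.toOrderHom b → a = b := by
      intro a ha b hb hac hbc hab
      refine Fin.succ_injective _ (h ((succ_mem_doubleFace hac).2 ha)
        ((succ_mem_doubleFace hbc).2 hb) ?_)
      rw [doubleMap_succ θ hac, doubleMap_succ θ hbc, hab]
    -- By monotonicity `c` has the same image as `a` and `b`. Since `c` occurs in the double on both
    -- sides of the cut, it links `a` to `b`.
    have mixed : ∀ a ∈ F, ∀ b ∈ F, a ≤ c → c ≤ b → θ.toOrderHom a = θ.toOrderHom b → a = b := by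
      intro a ha b hb hac hbc hab
      have h1 : θ.toOrderHom a = θ.toOrderHom c :=
        le_antisymm (θ.toOrderHom.monotone hac) (hab ▸ θ.toOrderHom.monotone hbc)
      exact (low a ha c hc hac le_rfl h1).trans (high c hc b hb le_rfl hbc (h1.symm.trans hab))
    intro a ha b hb hab
    rcases le_total a c with h1 | h1 <;> rcases le_total b c with h2 | h2
    · exact low a ha b hb h1 h2 hab
    · exact mixed a ha b hb h1 h2 hab
    · exact (mixed b hb a ha h2 h1 hab.symm).symm
    · exact high a ha b hb h1 h2 hab
  · intro h (i : Fin (τ.dim + 2)) hi (j : Fin (τ.dim + 2)) hj hij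
    have hp : c.predAbove i = c.predAbove j := by
      refine h (mem_doubleFace.1 hi) (mem_doubleFace.1 hj) ?_
      rw [← predAbove_doubleMap, ← predAbove_doubleMap, hij]
    -- A vertex of the double is determined by its image under the collapse and its side of the cut.
    have hc : τ.doubleCut c i = τ.doubleCut c j := by
      rw [← doubleCut_comp_doubleMap θ]
      exact congrArg (σ.doubleCut (θ.toOrderHom c)) hij
    change (if c.castSucc < i then (1 : Fin 2) else 0) = if c.castSucc < j then 1 else 0 at hc
    rcases c.eq_castSucc_or_eq_succ i with ⟨u, hu, rfl⟩ | ⟨u, hu, rfl⟩ <;>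
      rcases c.eq_castSucc_or_eq_succ j with ⟨w, hw, rfl⟩ | ⟨w, hw, rfl⟩
    · rw [Fin.predAbove_castSucc_of_le _ _ hu, Fin.predAbove_castSucc_of_le _ _ hw] at hp
      rw [hp]
    · rw [if_neg (by simpa using hu), if_pos (Fin.castSucc_lt_succ_iff.2 hw)] at hc
      exact absurd hc zero_ne_one
    · rw [if_pos (Fin.castSucc_lt_succ_iff.2 hu), if_neg (by simpa using hw)] at hc
      exact absurd hc one_ne_zero
    · rw [Fin.predAbove_succ_of_le _ _ hu, Fin.predAbove_succ_of_le _ _ hw] at hp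
      rw [hp]

theorem image_doubleMap {τ σ : NerveSimplex P} (θ : τ ⟶ σ) {c : Fin (τ.dim + 1)}
    {F : Finset (Fin (τ.dim + 1))} (hc : c ∈ F)
    (hθ : Set.InjOn θ.toOrderHom (F : Set (Fin (τ.dim + 1)))) :
    (doubleFace c F).image (doubleMap θ c).toOrderHom =
      doubleFace (θ.toOrderHom c) (F.image θ.toOrderHom) := by
  ext (j : Fin (σ.dim + 2))
  simp only [Finset.mem_image, mem_doubleFace]
  constructor
  · rintro ⟨i, hi, rfl⟩
    exact ⟨_, hi, (predAbove_doubleMap θ c i).symm⟩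
  · rintro ⟨u, hu, huj⟩
    rcases (θ.toOrderHom c).eq_castSucc_or_eq_succ j with ⟨w, hw, rfl⟩ | ⟨w, hw, rfl⟩
    · rw [Fin.predAbove_castSucc_of_le _ _ hw] at huj
      subst huj
      -- Otherwise `u > c` would have the same image as `c`, against injectivity on `F`.
      have huc : u ≤ c := by
        by_contra h
        exact h (hθ hu hc (le_antisymm hw (θ.toOrderHom.monotone (not_le.1 h).le))).le
      exact ⟨u.castSucc, by rwa [Fin.predAbove_castSucc_of_le _ _ huc], doubleMap_castSucc θ huc⟩
    · rw [Fin.predAbove_succ_of_le _ _ hw] at huj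
      subst huj
      have huc : c ≤ u := by
        by_contra h
        exact h (hθ hu hc (le_antisymm (θ.toOrderHom.monotone (not_le.1 h).le) hw)).ge
      exact ⟨u.succ, by rwa [Fin.predAbove_succ_of_le _ _ huc], doubleMap_succ θ huc⟩

/-- A vertex other than `c` has a single copy in the double, namely `c.castSucc.succAbove v`. -/
theorem doubleFace_erase_succAbove {σ : NerveSimplex P} {c v : Fin (σ.dim + 1)}
    (hv : v ≠ c) (F : Finset (Fin (σ.dim + 1))) :
    (doubleFace c F).erase (c.castSucc.succAbove v) = doubleFace c (F.erase v) := by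
  ext (i : Fin (σ.dim + 2))
  simp only [Finset.mem_erase, mem_doubleFace]
  refine and_congr_left fun _ => not_congr ⟨?_, ?_⟩
  · rintro rfl
    exact c.predAbove_succAbove v
  · intro h
    by_cases hi : i = c.castSucc
    · rw [hi, Fin.predAbove_castSucc_of_le _ _ le_rfl] at h
      exact absurd h.symm hv
    · obtain ⟨u, rfl⟩ := Fin.exists_succAbove_eq hi
      rw [c.predAbove_succAbove] at h
      rw [h]

end NerveSimplex

/-! ### Signs and the prism operator on one simplex. -/

namespace BlowUp

open NerveSimplex

variable {P : Type u} [PartialOrder P] {R : Type u} [CommRing R]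

theorem vertexSign_eq_erase_of_le {σ : NerveSimplex P} {F : Finset (Fin (σ.dim + 1))}
    (G : Finset P) {a v : Fin (σ.dim + 1)} (h : v ≤ a) :
    vertexSign σ F G v = vertexSign σ (F.erase a) G v := by
  unfold vertexSign
  rw [Finset.filter_erase, Finset.erase_eq_of_notMem]
  simp [h]

theorem vertexSign_eq_erase_add_one {σ : NerveSimplex P} {F : Finset (Fin (σ.dim + 1))}
    (G : Finset P) {a v : Fin (σ.dim + 1)} (ha : a ∈ F) (h : a < v) :
    vertexSign σ F G v = vertexSign σ (F.erase a) G v + 1 := by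
  unfold vertexSign
  rw [Finset.filter_erase, ← Finset.card_erase_add_one (Finset.mem_filter.2 ⟨ha, h⟩)]
  ring

open scoped Classical in
theorem apexSign_eq_erase_of_lt {σ : NerveSimplex P} {F : Finset (Fin (σ.dim + 1))}
    (G : Finset P) {a : Fin (σ.dim + 1)} {s : P} (h : s < σ.vertex a) :
    apexSign σ F G s = apexSign σ (F.erase a) G s := by
  unfold apexSign
  rw [Finset.filter_erase, Finset.erase_eq_of_notMem]
  simp [h.not_ge]

open scoped Classical in
theorem apexSign_eq_erase_add_one {σ : NerveSimplex P} {F : Finset (Fin (σ.dim + 1))}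
    (G : Finset P) {a : Fin (σ.dim + 1)} {s : P} (ha : a ∈ F) (h : σ.vertex a ≤ s) :
    apexSign σ F G s = apexSign σ (F.erase a) G s + 1 := by
  unfold apexSign
  rw [Finset.filter_erase, ← Finset.card_erase_add_one (Finset.mem_filter.2 ⟨ha, h⟩)]
  ring

open scoped Classical in
theorem vertexSign_insert_of_lt {σ : NerveSimplex P} (F : Finset (Fin (σ.dim + 1)))
    {G : Finset P} {v : Fin (σ.dim + 1)} {s : P} (hs : s ∉ G) (h : s < σ.vertex v) :
    vertexSign σ F (insert s G) v = vertexSign σ F G v + 1 := by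
  unfold vertexSign
  rw [Finset.filter_insert, if_pos h, Finset.card_insert_of_notMem (by simp [hs])]
  ring

open scoped Classical in
theorem vertexSign_insert_of_le {σ : NerveSimplex P} (F : Finset (Fin (σ.dim + 1)))
    (G : Finset P) {v : Fin (σ.dim + 1)} {s : P} (h : σ.vertex v ≤ s) :
    vertexSign σ F (insert s G) v = vertexSign σ F G v := by
  unfold vertexSign
  rw [Finset.filter_insert, if_neg h.not_gt]

open scoped Classical in
theorem perverseDegree_mono {σ : NerveSimplex P} {F F' : Finset (Fin (σ.dim + 1))} (G : Finset P)
    (s : P) (h : F ⊆ F') : perverseDegree F G s ≤ perverseDegree F' G s := by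
  unfold perverseDegree
  split_ifs with hs
  · have := Finset.card_le_card (Finset.filter_subset_filter (fun v => s < σ.vertex v) h)
    simp only [WithBot.coe_le_coe, WithTop.coe_le_coe, faceDim]
    gcongr
  · exact le_rfl

section Double

variable {σ : NerveSimplex P}

theorem coned_doubleFace (c : Fin (σ.dim + 1)) (F : Finset (Fin (σ.dim + 1))) (G : Finset P) :
    coned (σ.double c) (doubleFace c F) G = coned σ F G := by
  unfold coned
  rw [image_vertex_doubleFace]

/-- The upper copy of `c` is not counted in this sign, and erasing it leaves the image of `F` under
a face map. -/
theorem vertexSign_doubleFace_castSucc {c : Fin (σ.dim + 1)} {F : Finset (Fin (σ.dim + 1))}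
    (G : Finset P) (hc : c ∈ F) :
    vertexSign (σ.double c) (doubleFace c F) G c.castSucc = vertexSign σ F G c := by
  rw [vertexSign_eq_erase_of_le G (a := c.succ) (Fin.castSucc_le_succ c),
    ← image_coface c c.succ c.predAbove_succ_succAbove,
    ← vertexSign_image (σ.coface c c.succ c.predAbove_succ_succAbove) G
      (coface_injective _ _ _ _).injOn hc, coface_apply, Fin.succAbove_succ_self]

/-- The extra `1` counts the lower copy of `c`. It gives the two walls opposite signs in the
boundary of the double. -/
theorem vertexSign_doubleFace_succ {c : Fin (σ.dim + 1)} {F : Finset (Fin (σ.dim + 1))}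
    (G : Finset P) (hc : c ∈ F) :
    vertexSign (σ.double c) (doubleFace c F) G c.succ = vertexSign σ F G c + 1 := by
  rw [vertexSign_eq_erase_add_one G (a := c.castSucc) ((castSucc_mem_doubleFace le_rfl).2 hc)
      Fin.castSucc_lt_succ,
    ← image_coface c c.castSucc c.predAbove_succAbove,
    ← vertexSign_image (σ.coface c c.castSucc c.predAbove_succAbove) G
      (coface_injective _ _ _ _).injOn hc, coface_apply, Fin.succAbove_castSucc_self]

/-- The signs with which the removal of a vertex anticommutes with doubling another one. -/
theorem vertexSign_doubleFace_succAbove {c v : Fin (σ.dim + 1)} {F : Finset (Fin (σ.dim + 1))}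
    (G : Finset P) (hc : c ∈ F) (hv : v ∈ F) (hvc : v ≠ c) :
    (-1 : R) ^ vertexSign σ F G c *
        (-1) ^ vertexSign (σ.double c) (doubleFace c F) G (c.castSucc.succAbove v) =
      -((-1) ^ vertexSign σ F G v * (-1) ^ vertexSign σ (F.erase v) G c) := by
  have key : vertexSign (σ.double c) ((doubleFace c F).erase c.castSucc) G
      (c.castSucc.succAbove v) = vertexSign σ F G v := by
    rw [← image_coface c c.castSucc c.predAbove_succAbove,
      ← vertexSign_image (σ.coface c c.castSucc c.predAbove_succAbove) G
      (coface_injective _ _ _ _).injOn hv, coface_apply]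
  -- Exactly one count shifts by one: that of `c` when `v < c`, because `v` gets removed, and that
  -- of `v` when `v > c`, because `c` gets doubled.
  rcases lt_or_gt_of_ne hvc with h | h
  · rw [vertexSign_eq_erase_of_le (σ := σ.double c) G (a := c.castSucc), key,
      vertexSign_eq_erase_add_one G hv h, pow_succ]
    · ring
    · rw [Fin.succAbove_castSucc_of_lt _ _ h]
      exact Fin.castSucc_le_castSucc_iff.2 h.le
  · rw [vertexSign_eq_erase_add_one (σ := σ.double c) G (a := c.castSucc)
      ((castSucc_mem_doubleFace le_rfl).2 hc), key, vertexSign_eq_erase_of_le G h.le, pow_succ]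
    · ring
    · rw [Fin.succAbove_castSucc_of_le _ _ h.le]
      exact Fin.castSucc_lt_succ_iff.2 h.le

open scoped Classical in
/-- The signs with which the removal of an apex anticommutes with doubling a vertex. -/
theorem apexSign_doubleFace {c : Fin (σ.dim + 1)} {F : Finset (Fin (σ.dim + 1))}
    {G : Finset P} {s : P} (hc : c ∈ F) (hs : s ∈ coned σ F G) :
    (-1 : R) ^ vertexSign σ F G c * (-1) ^ apexSign (σ.double c) (doubleFace c F) G s =
      -((-1) ^ apexSign σ F G s * (-1) ^ vertexSign σ F (insert s G) c) := by
  have key : apexSign (σ.double c) ((doubleFace c F).erase c.castSucc) G s = apexSign σ F G s := by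
    rw [← image_coface c c.castSucc c.predAbove_succAbove,
      ← apexSign_image (σ.coface c c.castSucc c.predAbove_succAbove) G s
      (coface_injective _ _ _ _).injOn]
  have hv : (σ.double c).vertex c.castSucc = σ.vertex c := by
    rw [double_vertex, Fin.predAbove_castSucc_of_le _ _ le_rfl]
  simp only [coned, Finset.mem_filter, Finset.mem_sdiff, Finset.mem_image] at hs
  obtain ⟨⟨⟨w, _, rfl⟩, hG⟩, _⟩ := hs
  have hcmp : σ.vertex c ≤ σ.vertex w ∨ σ.vertex w < σ.vertex c := by
    rcases le_total c w with h | h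
    · exact Or.inl (σ.vertex.monotone h)
    · rcases (σ.vertex.monotone h).eq_or_lt with h' | h'
      · exact Or.inl h'.ge
      · exact Or.inr h'
  -- Again exactly one count shifts: the apex sign, through the second copy of `c`, when `c` lies in
  -- a stratum `≤ s`; the sign of `c`, through the insertion of `s` in `G`, otherwise.
  rcases hcmp with h | h
  · rw [apexSign_eq_erase_add_one (σ := σ.double c) G (a := c.castSucc)
      ((castSucc_mem_doubleFace le_rfl).2 hc) (hv.le.trans h), key,
      vertexSign_insert_of_le F G h, pow_succ]
    ring
  · rw [apexSign_eq_erase_of_lt (σ := σ.double c) G (a := c.castSucc) (h.trans_le hv.ge), key,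
      vertexSign_insert_of_lt F hG h, pow_succ]
    ring

theorem sum_doubleFace {M : Type*} [AddCommMonoid M] {c : Fin (σ.dim + 1)}
    {F : Finset (Fin (σ.dim + 1))} (hc : c ∈ F) (f : Fin ((σ.double c).dim + 1) → M) :
    ∑ i ∈ doubleFace c F, f i =
      f c.castSucc + (f c.succ + ∑ v ∈ F.erase c, f (c.castSucc.succAbove v)) := by
  rw [← Finset.add_sum_erase _ _ ((castSucc_mem_doubleFace le_rfl).2 hc),
    ← image_coface c c.castSucc c.predAbove_succAbove,
    Finset.sum_image (coface_injective _ _ _ _).injOn, ← Finset.add_sum_erase _ _ hc]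
  simp only [coface_apply, Fin.succAbove_castSucc_self]

/-- The prism operator on one simplex `σ`: the family `ω` gives the values on the maximal simplices
of `σ × Δ[1]`, which are indexed by the vertices of `σ`. -/
noncomputable def prism (ω : ∀ c, Coeffs R (σ.double c)) : Coeffs R σ :=
  fun F G => ∑ c ∈ F, (-1) ^ vertexSign σ F G c * ω c (doubleFace c F) G

/-- The cocycle condition for `ω c` on the double of `F` at `c ∈ F` expresses the difference of its
two walls through the remaining boundary terms. Summed over `c`, the walls telescope to the two
ends, and the remaining terms form the differential of the prism. -/
theorem coboundary_prism {ω : ∀ c, Coeffs R (σ.double c)}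
    (hω : ∀ c, coboundary (σ.double c) (ω c) = 0)
    {α : Fin (σ.dim + 2) → Coeffs R σ}
    (h0 : ∀ c, α c.castSucc = pullback (σ.coface c c.castSucc c.predAbove_succAbove) (ω c))
    (h1 : ∀ c, α c.succ = pullback (σ.coface c c.succ c.predAbove_succ_succAbove) (ω c)) :
    coboundary σ (prism ω) = α 0 - α (Fin.last _) := by
  classical
  funext F G
  have k0 : ∀ c, α c.castSucc F G = ω c ((doubleFace c F).erase c.castSucc) G := fun c => by
    rw [h0, pullback_apply_of_injOn _ _ _ (coface_injective _ _ _ _).injOn, image_coface]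
  have k1 : ∀ c, α c.succ F G = ω c ((doubleFace c F).erase c.succ) G := fun c => by
    rw [h1, pullback_apply_of_injOn _ _ _ (coface_injective _ _ _ _).injOn, image_coface]
  have telescope : ∑ c ∈ F, (α c.castSucc F G - α c.succ F G) =
      α 0 F G - α (Fin.last _) F G := by
    rw [Finset.sum_subset (Finset.subset_univ F)]
    · rw [Finset.sum_sub_distrib, sub_eq_sub_iff_add_eq_add,
        ← Fin.sum_univ_castSucc (fun k => α k F G), ← Fin.sum_univ_succ (fun k => α k F G)]
    -- For `c ∉ F` the double contains neither copy of `c`, so both walls carry the same value and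
    -- the sum may run over all vertices.
    · intro c _ hc
      rw [k0, k1, Finset.erase_eq_of_notMem, Finset.erase_eq_of_notMem, sub_self]
      · rwa [succ_mem_doubleFace le_rfl]
      · rwa [castSucc_mem_doubleFace le_rfl]
  have cocycle : ∀ c ∈ F, α c.castSucc F G - α c.succ F G =
      (∑ v ∈ F.erase c, (-1) ^ vertexSign σ F G v * ((-1) ^ vertexSign σ (F.erase v) G c *
          ω c (doubleFace c (F.erase v)) G)) +
        ∑ s ∈ coned σ F G, (-1) ^ apexSign σ F G s * ((-1) ^ vertexSign σ F (insert s G) c *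
          ω c (doubleFace c F) (insert s G)) := by
    intro c hc
    have h := congrFun (congrFun (hω c) (doubleFace c F)) G
    rw [coboundary_apply, coned_doubleFace, sum_doubleFace hc, vertexSign_doubleFace_castSucc G hc,
      vertexSign_doubleFace_succ G hc, ← k0, ← k1, Pi.zero_apply, Pi.zero_apply] at h
    have h' := congrArg (fun x => (-1 : R) ^ vertexSign σ F G c * x) h
    have hsq : (-1 : R) ^ vertexSign σ F G c * (-1) ^ vertexSign σ F G c = 1 := by
      rw [← mul_pow, neg_one_mul, neg_neg, one_pow]
    have e1 : (-1 : R) ^ vertexSign σ F G c * ∑ v ∈ F.erase c,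
        (-1) ^ vertexSign (σ.double c) (doubleFace c F) G (c.castSucc.succAbove v) *
          ω c ((doubleFace c F).erase (c.castSucc.succAbove v)) G =
        -∑ v ∈ F.erase c, (-1) ^ vertexSign σ F G v * ((-1) ^ vertexSign σ (F.erase v) G c *
          ω c (doubleFace c (F.erase v)) G) := by
      rw [Finset.mul_sum, ← Finset.sum_neg_distrib]
      refine Finset.sum_congr rfl fun v hv => ?_
      obtain ⟨hvc, hv⟩ := Finset.mem_erase.1 hv
      rw [← mul_assoc, vertexSign_doubleFace_succAbove G hc hv hvc, doubleFace_erase_succAbove hvc]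
      ring
    have e2 : (-1 : R) ^ vertexSign σ F G c * ∑ s ∈ coned σ F G,
        (-1) ^ apexSign (σ.double c) (doubleFace c F) G s *
          ω c (doubleFace c F) (insert s G) =
        -∑ s ∈ coned σ F G, (-1) ^ apexSign σ F G s * ((-1) ^ vertexSign σ F (insert s G) c *
          ω c (doubleFace c F) (insert s G)) := by
      rw [Finset.mul_sum, ← Finset.sum_neg_distrib]
      refine Finset.sum_congr rfl fun s hs => ?_
      rw [← mul_assoc, apexSign_doubleFace hc hs]
      ring
    simp only [mul_add, e1, e2] at h'
    linear_combination h' - (α c.castSucc F G - α c.succ F G) * hsq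
  rw [Pi.sub_apply, Pi.sub_apply, ← telescope, Finset.sum_congr rfl cocycle,
    Finset.sum_add_distrib, coboundary_apply]
  simp only [prism, Finset.mul_sum]
  congr 1
  -- Both sides run over the ordered pairs of distinct vertices of `F`.
  · refine Finset.sum_comm' fun v c => ?_
    simp only [Finset.mem_erase]
    tauto
  · exact Finset.sum_comm

/-- Doubling `c ∈ F` adds one vertex and changes neither `G` nor the strata met by the face. -/
theorem prism_mem_cochains {n : ℤ} {ω : ∀ c, Coeffs R (σ.double c)}
    (hω : ∀ c, ω c ∈ cochains R n (σ.double c)) : prism ω ∈ cochains R (n - 1) σ := by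
  classical
  intro F G h
  obtain ⟨c, hc, hne⟩ := Finset.exists_ne_zero_of_sum_ne_zero h
  obtain ⟨⟨hr, hl, hs⟩, hd⟩ := hω c _ _ (right_ne_zero_of_mul hne)
  refine ⟨isFace_of_isFace_image (σ.coface c c.castSucc c.predAbove_succAbove)
    ⟨hr, hl, ?_⟩, ?_⟩
  · rw [image_vertex_doubleFace, ← image_vertex (σ.coface c c.castSucc c.predAbove_succAbove)] at hs
    exact hs
  · have := card_doubleFace hc
    unfold faceDim at hd ⊢
    omega

/-- `F` is a face of its double with the same `G`, so its perverse degrees are no larger. -/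
theorem prism_mem_allowable {p : Perversity P} {ω : ∀ c, Coeffs R (σ.double c)}
    (hω : ∀ c, ω c ∈ allowable R p (σ.double c)) : prism ω ∈ allowable R p σ := by
  classical
  intro F G h s
  obtain ⟨c, hc, hne⟩ := Finset.exists_ne_zero_of_sum_ne_zero h
  refine le_trans ?_ (hω c _ _ (right_ne_zero_of_mul hne) s)
  rw [← perverseDegree_image (σ.coface c c.castSucc c.predAbove_succAbove) G s
    (coface_injective _ _ _ _).injOn, image_coface]
  exact perverseDegree_mono G s (Finset.erase_subset _ _)

theorem pullback_prism {τ : NerveSimplex P} (θ : τ ⟶ σ) (ω : ∀ c, Coeffs R (σ.double c)) :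
    pullback θ (prism ω) = prism fun c => pullback (doubleMap θ c) (ω (θ.toOrderHom c)) := by
  classical
  funext F G
  by_cases hθ : Set.InjOn θ.toOrderHom (F : Set (Fin (τ.dim + 1)))
  · rw [pullback_apply_of_injOn _ _ _ hθ]
    unfold prism
    rw [Finset.sum_image hθ]
    refine Finset.sum_congr rfl fun c hc => ?_
    dsimp only
    rw [pullback_apply_of_injOn _ _ _ ((injOn_doubleMap_iff θ hc).2 hθ), image_doubleMap θ hc hθ,
      vertexSign_image θ G hθ hc]
  · rw [pullback_apply_of_not_injOn _ _ _ hθ]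
    symm
    refine Finset.sum_eq_zero fun c hc => ?_
    dsimp only
    rw [pullback_apply_of_not_injOn _ _ _ fun h => hθ ((injOn_doubleMap_iff θ hc).1 h), mul_zero]

end Double

end BlowUp

/-! ### Homotopic morphisms are cohomologous, and homotopy classes are cohomology classes. -/

section Cohomology

open NerveSimplex SSetOver

variable {P : Type u} [PartialOrder P] {R : Type u} [CommRing R]

/-- The simplex of the prism over `x` which doubles the vertex `c`. -/
def prismSimplex (L : SSetOver P) {σ : NerveSimplex P} (x : L.obj (op σ)) (c : Fin (σ.dim + 1)) :
    (cylinder L).obj (op (σ.double c)) :=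
  (L.map (σ.collapse c).op x, σ.doubleCut c)

theorem map_coface_prismSimplex (L : SSetOver P) {σ : NerveSimplex P} (x : L.obj (op σ))
    (c : Fin (σ.dim + 1)) (k : Fin (σ.dim + 2)) (hk : ∀ i, c.predAbove (k.succAbove i) = i) :
    (cylinder L).map (σ.coface c k hk).op (prismSimplex L x c) =
      (x, (σ.doubleCut c).comp (σ.coface c k hk).toOrderHom) := by
  refine Prod.ext ?_ rfl
  change L.map (σ.coface c k hk).op (L.map (σ.collapse c).op x) = x
  rw [← Functor.map_comp_apply, ← op_comp, coface_collapse, op_id,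
    Functor.map_id_apply]

theorem map_doubleMap_prismSimplex (L : SSetOver P) {τ σ : NerveSimplex P} (θ : τ ⟶ σ)
    (x : L.obj (op σ)) (c : Fin (τ.dim + 1)) :
    (cylinder L).map (doubleMap θ c).op (prismSimplex L x (θ.toOrderHom c)) =
      prismSimplex L (L.map θ.op x) c := by
  refine Prod.ext ?_ (doubleCut_comp_doubleMap θ c)
  change L.map (doubleMap θ c).op (L.map (σ.collapse _).op x) =
    L.map (τ.collapse c).op (L.map θ.op x)
  rw [← Functor.map_comp_apply, ← Functor.map_comp_apply, ← op_comp, ← op_comp,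
    doubleMap_collapse]

/-- The prism operator, from the cochains on `L ⊗ Δ[1]` to the cochains on `L`. -/
noncomputable def blownUpPrism (L : SSetOver P)
    (ω : ∀ σ : NerveSimplex P, (cylinder L).obj (op σ) → BlowUp.Coeffs R σ) :
    ∀ σ : NerveSimplex P, L.obj (op σ) → BlowUp.Coeffs R σ :=
  fun σ x => BlowUp.prism fun c => ω (σ.double c) (prismSimplex L x c)

theorem blownUpDifferential_blownUpPrism {p : Perversity P} {n : ℤ} {L : SSetOver P}
    {ω : ∀ σ : NerveSimplex P, (cylinder L).obj (op σ) → BlowUp.Coeffs R σ}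
    (hω : ω ∈ blownUpCocycles R p n (cylinder L)) :
    blownUpDifferential R L (blownUpPrism L ω) =
      blownUpPullback (endInclusion L 1) ω - blownUpPullback (endInclusion L 0) ω := by
  funext σ x
  -- The walls are the simplices `(x, σ.cut k)` of the cylinder.
  have h := BlowUp.coboundary_prism (ω := fun c => ω (σ.double c) (prismSimplex L x c))
    (α := fun k => ω σ (x, σ.cut k)) (fun c => congrFun (congrFun hω.2 (σ.double c)) _)
    (fun c => by
      rw [← hω.1.2, map_coface_prismSimplex, doubleCut_comp_coface_castSucc])
    (fun c => by
      rw [← hω.1.2, map_coface_prismSimplex, doubleCut_comp_coface_succ])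
  rw [cut_zero, cut_last] at h
  exact h

theorem blownUpPrism_mem_blownUpCochains {p : Perversity P} {n : ℤ} {L : SSetOver P}
    {ω : ∀ σ : NerveSimplex P, (cylinder L).obj (op σ) → BlowUp.Coeffs R σ}
    (hω : ω ∈ blownUpCocycles R p n (cylinder L)) :
    blownUpPrism L ω ∈ blownUpCochains R p (n - 1) L := by
  refine ⟨fun σ x => ⟨⟨BlowUp.prism_mem_cochains fun c => (hω.1.1 _ _).1.1,
    BlowUp.prism_mem_allowable fun c => (hω.1.1 _ _).1.2⟩, ?_⟩, fun τ σ θ x => ?_⟩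
  -- No estimate is needed for the differential of the prism: `ω` being a cocycle, it is the
  -- difference of two values of `ω`, each of them allowable.
  · have h := congrFun (congrFun (blownUpDifferential_blownUpPrism hω) σ) x
    change BlowUp.coboundary σ (blownUpPrism L ω σ x) ∈ BlowUp.allowable R p σ
    change BlowUp.coboundary σ (blownUpPrism L ω σ x) = ω σ _ - ω σ _ at h
    rw [h]
    exact sub_mem (hω.1.1 _ _).1.2 (hω.1.1 _ _).1.2
  · unfold blownUpPrism
    rw [BlowUp.pullback_prism]
    congr 1
    funext c
    rw [← hω.1.2, map_doubleMap_prismSimplex]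

theorem blownUpClass_eq_of_strictlyHomotopic {p : Perversity P} {n : ℤ} {L : SSetOver P}
    {f g : L ⟶ perverseEML R p n} (h : StrictlyHomotopic f g) :
    blownUpClass (cocycleOfHom f) = blownUpClass (cocycleOfHom g) := by
  obtain ⟨H, rfl, rfl⟩ := h
  exact (blownUpClass_eq_iff.2 ⟨_, blownUpPrism_mem_blownUpCochains (cocycleOfHom H).2,
    blownUpDifferential_blownUpPrism (cocycleOfHom H).2⟩).symm

/-- The morphisms to `K(R, n, P, p)` are strictly homotopic if and only if they define the same
cohomology class. -/
theorem strictlyHomotopic_iff {p : Perversity P} {n : ℤ} {L : SSetOver P}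
    {f g : L ⟶ perverseEML R p n} :
    StrictlyHomotopic f g ↔ blownUpClass (cocycleOfHom f) = blownUpClass (cocycleOfHom g) :=
  ⟨blownUpClass_eq_of_strictlyHomotopic, fun h => strictlyHomotopic_of_blownUpClass_eq h.symm⟩

/-- This makes `⟨g⟩ ↦ ⟨g ≫ f⟩` independent of the representative `g`, although `f` need not be
additive. -/
theorem SSetOver.StrictlyHomotopic.comp {L K K' : SSetOver P} {f g : L ⟶ K}
    (h : StrictlyHomotopic f g) (k : K ⟶ K') : StrictlyHomotopic (f ≫ k) (g ≫ k) := by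
  obtain ⟨H, rfl, rfl⟩ := h
  exact ⟨H ≫ k, rfl, rfl⟩

theorem exists_hom_blownUpClass_eq {p : Perversity P} {n : ℤ} {L : SSetOver P}
    (x : BlownUpCohomology R p n L) :
    ∃ f : L ⟶ perverseEML R p n, blownUpClass (cocycleOfHom f) = x := by
  obtain ⟨ω, rfl⟩ := blownUpClass_surjective x
  exact ⟨homOfCocycle ω, rfl⟩

/-- Homotopy classes of morphisms to `K(R, n, P, p)` are cohomology classes. -/
noncomputable def homotopyClassesEquiv (p : Perversity P) (n : ℤ) (L : SSetOver P) :
    HomotopyClasses L (perverseEML R p n) ≃ BlownUpCohomology R p n L :=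
  Equiv.ofBijective
    (Quot.lift (fun f => blownUpClass (cocycleOfHom f))
      fun _ _ => blownUpClass_eq_of_strictlyHomotopic)
    ⟨by
      rintro ⟨f⟩ ⟨g⟩ h
      exact Quot.sound (strictlyHomotopic_iff.2 h), fun x => by
      obtain ⟨f, hf⟩ := exists_hom_blownUpClass_eq x
      exact ⟨homotopyClass f, hf⟩⟩

end Cohomology

/-! ### Operations and the fundamental class. -/

namespace PerverseOperation

variable {P : Type u} [PartialOrder P] {R : Type u} [CommRing R] {p : Perversity P} {n : ℤ}
  {q : Perversity P} {m : ℤ}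

/-- The Yoneda argument: `⟨g⟩` is the pullback along `g` of the fundamental class. -/
theorem eval_blownUpClass (θ : PerverseOperation R p n q m) {L : SSetOver P}
    (g : L ⟶ perverseEML R p n) :
    θ.eval L (blownUpClass (cocycleOfHom g)) =
      blownUpCohomologyMap g q m (θ.eval (perverseEML R p n) (fundamentalClass R p n)) :=
  NatTrans.naturality_apply θ g.op (fundamentalClass R p n)

/-- The operation `⟨g⟩ ↦ ⟨g ≫ f⟩`. -/
noncomputable def ofHom (f : perverseEML R p n ⟶ perverseEML R q m) :
    PerverseOperation R p n q m :=
  (equivNaturalFamilies R p n q m).symm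
    ⟨fun L x => blownUpClass (cocycleOfHom ((exists_hom_blownUpClass_eq x).choose ≫ f)), by
      intro L L' g x
      rw [blownUpCohomologyMap_blownUpClass, blownUpCocyclesMap_cocycleOfHom, ← Category.assoc,
        ← strictlyHomotopic_iff]
      -- The representative chosen for the pullback of `x` and the composite of `g` with the one
      -- chosen for `x` have the same class, hence are homotopic.
      refine SSetOver.StrictlyHomotopic.comp (strictlyHomotopic_iff.2 ?_) f
      rw [(exists_hom_blownUpClass_eq _).choose_spec, ← blownUpCocyclesMap_cocycleOfHom,
        ← blownUpCohomologyMap_blownUpClass, (exists_hom_blownUpClass_eq _).choose_spec]⟩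

theorem ofHom_eval (f : perverseEML R p n ⟶ perverseEML R q m) {L : SSetOver P}
    (g : L ⟶ perverseEML R p n) :
    (ofHom f).eval L (blownUpClass (cocycleOfHom g)) = blownUpClass (cocycleOfHom (g ≫ f)) := by
  change blownUpClass (cocycleOfHom ((exists_hom_blownUpClass_eq _).choose ≫ f)) = _
  rw [← strictlyHomotopic_iff]
  exact SSetOver.StrictlyHomotopic.comp
    (strictlyHomotopic_iff.2 (exists_hom_blownUpClass_eq _).choose_spec) f

variable (R p n q m) in
/-- The evaluation of the operations on the fundamental class. -/
noncomputable def evalFundamentalClass :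
    PerverseOperation R p n q m →ₗ[R] BlownUpCohomology R q m (perverseEML R p n) where
  toFun θ := θ.eval (perverseEML R p n) (fundamentalClass R p n)
  map_add' _ _ := rfl
  map_smul' _ _ := rfl

theorem evalFundamentalClass_ofHom (f : perverseEML R p n ⟶ perverseEML R q m) :
    evalFundamentalClass R p n q m (ofHom f) = blownUpClass (cocycleOfHom f) :=
  ofHom_eval f (𝟙 _)

theorem evalFundamentalClass_bijective :
    Function.Bijective (evalFundamentalClass R p n q m) := by
  constructor
  · intro θ θ' h
    refine (equivNaturalFamilies R p n q m).injective (Subtype.ext ?_)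
    funext L x
    obtain ⟨g, rfl⟩ := exists_hom_blownUpClass_eq x
    change θ.eval L _ = θ'.eval L _
    rw [eval_blownUpClass, eval_blownUpClass]
    exact congrArg _ h
  · intro x
    obtain ⟨f, rfl⟩ := exists_hom_blownUpClass_eq x
    exact ⟨ofHom f, evalFundamentalClass_ofHom f⟩

end PerverseOperation

theorem theorem3 {P R : Type u} [PartialOrder P] [CommRing R] (p q : Perversity P) (n m : ℤ) :
    ∃ (Φ : SSetOver.HomotopyClasses (perverseEML R p n) (perverseEML R q m) ≃
          PerverseOperation R p n q m)
      (e : PerverseOperation R p n q m ≃ₗ[R] BlownUpCohomology R q m (perverseEML R p n)),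
      (∀ (f : perverseEML R p n ⟶ perverseEML R q m) (L : SSetOver P) (g : L ⟶ perverseEML R p n),
        (Φ (SSetOver.homotopyClass f)).eval L (blownUpClass (cocycleOfHom g)) =
          blownUpClass (cocycleOfHom (g ≫ f))) ∧
      (∀ θ : PerverseOperation R p n q m,
        e θ = θ.eval (perverseEML R p n) (fundamentalClass R p n)) ∧
      (∀ f : perverseEML R p n ⟶ perverseEML R q m,
        e (Φ (SSetOver.homotopyClass f)) = blownUpClass (cocycleOfHom f)) := by
  let e := LinearEquiv.ofBijective (PerverseOperation.evalFundamentalClass R p n q m)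
    PerverseOperation.evalFundamentalClass_bijective
  -- This definition makes `Φ` bijective at once; its description as composition with `f` follows by
  -- comparing values on the fundamental class.
  let Φ := (homotopyClassesEquiv q m (perverseEML R p n)).trans e.symm.toEquiv
  have hΦ : ∀ f : perverseEML R p n ⟶ perverseEML R q m,
      Φ (SSetOver.homotopyClass f) = PerverseOperation.ofHom f := fun f =>
    (LinearEquiv.symm_apply_eq e).2 (PerverseOperation.evalFundamentalClass_ofHom f).symm
  refine ⟨Φ, e, fun f L g => ?_, fun θ => rfl, fun f => ?_⟩
  · rw [hΦ, PerverseOperation.ofHom_eval]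
  · rw [hΦ]
    exact PerverseOperation.evalFundamentalClass_ofHom f
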